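/- **Theorem (LA policy).** Let $0<v<1$, $\rho>0$, $\lambda>0$ and $D-\rho\ge v\pi\rho$. Targets are generated from time $0$ on, at the times $a_0<a_1<\dots$ of a Poisson process of rate $\lambda$, at independent uniformly distributed angles $\theta_i$ on the circle of radius $D$ around the origin; each target then moves radially inward with speed $v$, so that at time $t$ it has polar coordinates $(r_i(t),\theta_i)$, $r_i(t)=D-v(t-a_i)$, and reaches the perimeter $\{r=\rho\}$ at time $a_i+(D-\rho)/v$. A vehicle moves with speed at most $1$ along the perimeter. It captures a target if it is collocated with it; a target escapes if it reaches the perimeter without being captured. With $n_{\rm capt}(t)$, $n_{\rm esc}(t)$ the numbers of targets captured, resp. escaped, by time $t$, the capture fraction of a policy $\mathcal P$ is $$\mathbb F_{\rm cap}(\mathcal P)=\limsup_{t\to\infty}\ \mathbb E\left[\frac{n_{\rm capt}(t)}{n_{\rm capt}(t)+n_{\rm esc}(t)}\right]$$ (with the ratio read as $0$ if no target has been captured or has escaped yet). Write $|\theta-\phi|\in[0,\pi]$ for the angular distance. The reachability graph of a set of targets at positions $(r_i,\theta_i)$ and of a vehicle at $(\rho,\phi)$ has an edge from target $j$ to target $k$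 iff $r_j<r_k$ and $r_k-r_j\ge v\rho|\theta_k-\theta_j|$, and an edge from the vehicle to target $k$ iff $r_k-\rho\ge v\rho|\theta_k-\phi|$. *Look-Ahead policy (LA).* At time $0$ the vehicle is at a given point $(\rho,\phi_0)$ of the perimeter. It computes a longest path (visiting the maximum number of targets), starting at its own position, in the reachability graph of all targets currently outstanding in $\{\rho<r\le D\}$, and captures the targets of this path, in order, when they reach the perimeter. When the last one has been captured, it repeats this from its current position; if the longest path contains no target, it waits where it is until the next target is generated, and then repeats. Ties between longest paths are broken by an arbitrary measurable rule that depends only on the positions of the vehicle and the outstanding targets. *Non-causal Look-Ahead policy (NCLA).* At time $0$, at the same point $(\rho,\phi_0)$, the vehicle knows all future targets, assigns to each of them its virtual position $(D+va_i,\theta_i)$ at time $0$, and computes a longest path, starting at its own position, in the resulting infinite reachability graph; it captures the targets of this path, in order, when they reach the perimeter. Here an infinite path is called longest if there is no other infinite path that, for all sufficiently large $R$, visits strictly more targets of (virtual) radius at most $R$. (The choice of a longest path may be any for which the vehicle position at each time is a random variable.) Then $$\mathbb F_{\rm cap}(\mathrm{LA})\ \ge\ \Bigl(1-\frac{v\pi\rho}{D-\rho}\Bigr)\,\mathbb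 F_{\rm cap}(\mathrm{NCLA}).$$ -/

import Mathlib

namespace RIT

/-- Angular coordinates, i.e. reals modulo `2π`. The norm `‖θ - φ‖` is the angular distance of
two directions, a number in `[0, π]`. -/
abbrev Angle : Type := AddCircle (2 * Real.pi)

noncomputable instance : Fact (0 < 2 * Real.pi) := ⟨Real.two_pi_pos⟩

/-! ### Reachability graph and longest paths -/

/-- A target with polar coordinates `x = (r, θ)` is reachable from the point `(ρ, φ)` of the
perimeter: it does not hit the perimeter before a unit speed vehicle that moves along the
perimeter can be there. -/
def Reachable (v ρ : ℝ) (φ : Angle) (x : ℝ × Angle) : Prop :=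
  v * ‖x.2 - φ‖ * ρ ≤ x.1 - ρ

/-- The edge relation of the reachability graph. -/
def Edge (v ρ : ℝ) (x y : ℝ × Angle) : Prop :=
  x.1 < y.1 ∧ Reachable v ρ x.2 (y.1 - (x.1 - ρ), y.2)

/-- A finite path, starting from the vehicle position `(ρ, φ)`, in the reachability graph of the
vehicle and of targets located at `x i`. The list contains the visited targets in order
(the vehicle itself is not listed). -/
def IsPath {ι : Type} (v ρ : ℝ) (φ : Angle) (x : ι → ℝ × Angle) (l : List ι) : Prop :=
  (∀ i ∈ l.head?, Reachable v ρ φ (x i)) ∧ l.IsChain (fun j k => Edge v ρ (x j) (x k))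

/-- A longest path from the vehicle position: one that visits as many targets as possible. -/
def IsLongestPath {ι : Type} (v ρ : ℝ) (φ : Angle) (x : ι → ℝ × Angle) (l : List ι) : Prop :=
  IsPath v ρ φ x l ∧ ∀ l' : List ι, IsPath v ρ φ x l' → l'.length ≤ l.length

/-- An infinite path from the vehicle position `(ρ, φ)` in the reachability graph of an infinite
sequence of targets. -/
def IsInfinitePath (v ρ : ℝ) (φ : Angle) (x : ℕ → ℝ × Angle) (w : ℕ → ℕ) : Prop :=
  Reachable v ρ φ (x (w 0)) ∧ ∀ n, Edge v ρ (x (w n)) (x (w (n + 1)))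

/-- The number of targets on the path `w` whose distance from the centre is at most `R`. -/
noncomputable def lengthUpTo (x : ℕ → ℝ × Angle) (w : ℕ → ℕ) (R : ℝ) : ℕ :=
  {n : ℕ | (x (w n)).1 ≤ R}.ncard

/-- A longest path in an infinite reachability graph: no other path visits, from some radius on,
always strictly more targets. -/
def IsLongestInfinitePath (v ρ : ℝ) (φ : Angle) (x : ℕ → ℝ × Angle) (w : ℕ → ℕ) : Prop :=
  IsInfinitePath v ρ φ x w ∧
    ∀ w' : ℕ → ℕ, IsInfinitePath v ρ φ x w' →
      ¬ ∃ R₀ : ℝ, ∀ R ≥ R₀, lengthUpTo x w R < lengthUpTo x w' R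

/-! ### Motion of targets and vehicle, capture and escape -/

/-- Polar coordinates at time `t` of a target generated at time `a` on the circle of radius `D`
in the direction `θ`. For `t < a` (not yet generated) this is the virtual position
that the target would have on its backward extended radial trajectory. -/
def location (v D : ℝ) (a : ℝ) (θ : Angle) (t : ℝ) : ℝ × Angle :=
  (D - v * (t - a), θ)

/-- The time at which a target generated at time `a` reaches the perimeter. -/
noncomputable def due (v ρ D : ℝ) (a : ℝ) : ℝ := a + (D - ρ) / v

/-- The targets in the environment at time `t` that have not yet reached the perimeter.
A vehicle on the perimeter can only capture targets that reach it, so these are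
the outstanding targets. -/
def outstanding (v ρ D : ℝ) (a : ℕ → ℝ) (θ : ℕ → Angle) (t : ℝ) : Set ℕ :=
  {i | a i ≤ t ∧ ρ < (location v D (a i) (θ i) t).1}

/-- `p t` is the angle of the vehicle, which moves on the perimeter with speed at most one. -/
def IsPerimeterMotion (ρ : ℝ) (p : ℝ → Angle) : Prop :=
  ∀ s t : ℝ, 0 ≤ s → s ≤ t → ρ * ‖p t - p s‖ ≤ t - s

/-- Target `i` is captured by time `t`: at some time up to `t` the vehicle, at `(ρ, p s)`, is
collocated with the target. -/
def CapturedBy (v ρ D : ℝ) (a : ℕ → ℝ) (θ : ℕ → Angle) (p : ℝ → Angle) (t : ℝ) (i : ℕ) : Prop :=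
  ∃ s : ℝ, a i ≤ s ∧ s ≤ t ∧ location v D (a i) (θ i) s = (ρ, p s)

/-- Target `i` has escaped by time `t`: it reached the perimeter without being captured. -/
def EscapedBy (v ρ D : ℝ) (a : ℕ → ℝ) (θ : ℕ → Angle) (p : ℝ → Angle) (t : ℝ) (i : ℕ) : Prop :=
  due v ρ D (a i) ≤ t ∧ ¬ CapturedBy v ρ D a θ p t i

noncomputable def nCapt (v ρ D : ℝ) (a : ℕ → ℝ) (θ : ℕ → Angle) (p : ℝ → Angle) (t : ℝ) : ℕ :=
  {i | CapturedBy v ρ D a θ p t i}.ncard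

noncomputable def nEsc (v ρ D : ℝ) (a : ℕ → ℝ) (θ : ℕ → Angle) (p : ℝ → Angle) (t : ℝ) : ℕ :=
  {i | EscapedBy v ρ D a θ p t i}.ncard

/-! ### The look-ahead policies -/

/-- A measurable rule by which the vehicle selects a longest path, given its position and the
positions of finitely many targets (ties may be broken in any way). -/
structure LongestPathRule (v ρ : ℝ) where
  path : (n : ℕ) → Angle → (Fin n → ℝ × Angle) → List (Fin n)
  longest : ∀ n φ x, IsLongestPath v ρ φ x (path n φ x)
  measurableSet : ∀ n (l : List (Fin n)),
    MeasurableSet {c : Angle × (Fin n → ℝ × Angle) | path n c.1 c.2 = l}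

/-- One iteration of the Look-Ahead policy, starting at time `t` and ending at time `t'`. Here
`e` enumerates the outstanding targets in order of generation. The vehicle captures
all targets of the selected path at the perimeter, and the iteration ends with the capture of
the last one. If no outstanding target can be captured, the vehicle waits until the
next target is generated. -/
def IsLAIteration (v ρ D : ℝ) (rule : LongestPathRule v ρ) (a : ℕ → ℝ) (θ : ℕ → Angle)
    (p : ℝ → Angle) (t t' : ℝ) : Prop :=
  ∃ (n : ℕ) (e : Fin n ↪o ℕ) (l : List (Fin n)),
    Set.range e = outstanding v ρ D a θ t ∧
    l = rule.path n (p t) (fun j => location v D (a (e j)) (θ (e j)) t) ∧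
    (∀ j ∈ l, p (due v ρ D (a (e j))) = θ (e j)) ∧
    (∀ j ∈ l.getLast?, t' = due v ρ D (a (e j))) ∧
    (l = [] → IsLeast {s : ℝ | t < s ∧ ∃ i, a i = s} t' ∧ ∀ s ∈ Set.Icc t t', p s = p t)

/-- The vehicle motion `p` follows the Look-Ahead policy from the initial angle `φ₀`: `τ k` is the
time at which the path is computed for the `k`-th time. -/
def FollowsLA (v ρ D : ℝ) (rule : LongestPathRule v ρ) (φ₀ : Angle) (a : ℕ → ℝ) (θ : ℕ → Angle)
    (p : ℝ → Angle) : Prop :=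
  IsPerimeterMotion ρ p ∧ p 0 = φ₀ ∧
    ∃ τ : ℕ → ℝ, τ 0 = 0 ∧ ∀ k, IsLAIteration v ρ D rule a θ p (τ k) (τ (k + 1))

/-- The vehicle motion `p` follows the Non-causal Look-Ahead policy from the initial angle `φ₀`: it
captures, in order, all targets on a longest path from its position at time `0` in the
reachability graph of all present and future targets. -/
def FollowsNCLA (v ρ D : ℝ) (φ₀ : Angle) (a : ℕ → ℝ) (θ : ℕ → Angle) (p : ℝ → Angle) : Prop :=
  IsPerimeterMotion ρ p ∧ p 0 = φ₀ ∧
    ∃ w : ℕ → ℕ,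
      IsLongestInfinitePath v ρ φ₀ (fun i => location v D (a i) (θ i) 0) w ∧
      ∀ n, p (due v ρ D (a (w n))) = θ (w n)

/-! ### Random targets and the capture fraction -/

section Probability

open MeasureTheory ProbabilityTheory

variable {Ω : Type*} [MeasurableSpace Ω]

/-- The time between the generation of targets `i - 1` and `i` (from time `0` for `i = 0`). -/
def interarrival (a : ℕ → Ω → ℝ) : ℕ → Ω → ℝ
  | 0, ω => a 0 ω
  | i + 1, ω => a (i + 1) ω - a i ω

/-- Targets are generated at the times `a 0 < a 1 < …` of a Poisson process of rate `lam` on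
`[0, ∞)` (independent exponential interarrival times), at independent uniformly distributed
angles. -/
structure IsTargetProcess (μ : Measure Ω) (lam : ℝ) (a : ℕ → Ω → ℝ) (θ : ℕ → Ω → Angle) :
    Prop where
  measurable_time : ∀ i, Measurable (a i)
  measurable_angle : ∀ i, Measurable (θ i)
  indep : iIndepFun (fun i ω => (interarrival a i ω, θ i ω)) μ
  law : ∀ i, μ.map (fun ω => (interarrival a i ω, θ i ω)) =
    (expMeasure lam).prod AddCircle.haarAddCircle

/-- The capture fraction `limsup_{t → ∞} E[n_capt(t) / (n_capt(t) + n_esc(t))]` of a random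
vehicle motion. -/
noncomputable def captureFraction (μ : Measure Ω) (v ρ D : ℝ) (a : ℕ → Ω → ℝ)
    (θ : ℕ → Ω → Angle) (p : Ω → ℝ → Angle) : ℝ :=
  Filter.limsup
    (fun t : ℝ => ∫ ω,
      (nCapt v ρ D (fun i => a i ω) (fun i => θ i ω) (p ω) t : ℝ) /
        ((nCapt v ρ D (fun i => a i ω) (fun i => θ i ω) (p ω) t : ℝ) +
          (nEsc v ρ D (fun i => a i ω) (fun i => θ i ω) (p ω) t : ℝ)) ∂μ)
    Filter.atTop

end Probability

end RIT

/-! Write T = (D - ρ) / v for the time a target needs to reach the perimeter, κ = 1 - πρ / T, and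
L(x) for the mean length of a longest chain of targets generated in a time window of length x
(`meanLongest`). A chain is a list of targets that a unit speed vehicle can meet one after the other
at the perimeter.

Upper bound: the targets captured up to time t by any motion along the perimeter, in particular by
NCLA, form a chain of targets generated up to t - T (`nCapt_le_longestChain`). On average there are
at most L(t - T) of them.

Lower bound: consider an LA iteration with a nonempty path and duration s; then s ≤ T. When it ends,
the targets generated during its last min(s, T - πρ) time units are outstanding, and none is due
before the time πρ in which the vehicle can reach any point. A longest chain of these targets is
thus an admissible path, and the next LA path is at least as long. Since s is determined by targets
generated before the iteration starts, the strong Markov property (`IsStopping.lintegral_splice`)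
makes the later targets a fresh Poisson process: given the past, the next iteration captures at
least L(min(s, T - πρ)) targets on average. Cutting chains shows that L is subadditive, whence x
L(u) ≤ (u + T) L(x) for 0 ≤ x ≤ T (`meanLongest_mul_le`). With u = t - T and min(s, T - πρ) ≥ κ s,
the mean number of captures is at least c s, where c = κ L(t - T) / t. A waiting iteration obeys the
same bound: its mean duration is 1/λ, a capture follows, and c ≤ λ because L(t - T) ≤ λ t
(`lintegral_duration_le`). The durations of the iterations begun up to time t add up to at least t,
so that κ L(t - T) ≤ E n_capt(t) + O(1) for LA (`ofReal_mul_meanLongest_le`,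
`tsum_length_planAt_le`).

Fractions: captured and escaped targets together are the targets generated up to t - T. Their number
divided by λ t tends to 1 in mean (`tendsto_integral_abs_one_sub`), so the random denominator may be
replaced by λ t, and the two bounds are compared in the limit superior. -/

namespace RIT

open MeasureTheory ProbabilityTheory Filter Topology
open scoped ENNReal

/-! ### Sequences of interarrival times and angles -/

/-- The generation time of target `i`, from the sequence of interarrival times and angles. -/
noncomputable def arrival (ξ : ℕ → ℝ × Angle) (i : ℕ) : ℝ := ∑ j ∈ Finset.range (i + 1), (ξ j).1

/-- The index of the first target generated after time `t`. -/
noncomputable def firstAfter (ξ : ℕ → ℝ × Angle) (t : ℝ) : ℕ := sInf {i | t < arrival ξ i}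

/-- Targets are generated at strictly increasing, unbounded, positive times. -/
def Regular (ξ : ℕ → ℝ × Angle) : Prop :=
  (∀ i, 0 < (ξ i).1) ∧ Tendsto (arrival ξ) atTop atTop

/-- The first `k` entries of `ξ`, followed by `η`. -/
def overwrite (k : ℕ) (ξ η : ℕ → ℝ × Angle) (i : ℕ) : ℝ × Angle :=
  if i < k then ξ i else η (i - k)

/-- The sequence in which the first target is delayed by `u`. -/
noncomputable def delay (u : ℝ) (ξ : ℕ → ℝ × Angle) : ℕ → ℝ × Angle :=
  Function.update ξ 0 (u + (ξ 0).1, (ξ 0).2)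

/-- The targets of `ξ` generated up to time `t`, then those of `η`, started at time `t`. -/
noncomputable def splice (t : ℝ) (ξ η : ℕ → ℝ × Angle) : ℕ → ℝ × Angle :=
  overwrite (firstAfter ξ t) ξ
    -- The first gap of `η` runs from time `t`, but an entry is measured from the preceding target.
    -- The time elapsed between that target and `t` is added.
    (delay (t - ∑ j ∈ Finset.range (firstAfter ξ t), (ξ j).1) η)

theorem arrival_succ (ξ : ℕ → ℝ × Angle) (i : ℕ) :
    arrival ξ (i + 1) = arrival ξ i + (ξ (i + 1)).1 := Finset.sum_range_succ _ _

theorem Regular.strictMono {ξ : ℕ → ℝ × Angle} (h : Regular ξ) : StrictMono (arrival ξ) :=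
  strictMono_nat_of_lt_succ fun i => by rw [arrival_succ]; linarith [h.1 (i + 1)]

theorem Regular.arrival_pos {ξ : ℕ → ℝ × Angle} (h : Regular ξ) (i : ℕ) : 0 < arrival ξ i :=
  Finset.sum_pos (fun j _ => h.1 j) ⟨0, by simp⟩

theorem arrival_le_of_lt_firstAfter {ξ : ℕ → ℝ × Angle} {t : ℝ} {i : ℕ} (h : i < firstAfter ξ t) :
    arrival ξ i ≤ t := not_lt.1 (Nat.notMem_of_lt_sInf h)

theorem Regular.lt_arrival_firstAfter {ξ : ℕ → ℝ × Angle} (h : Regular ξ) (t : ℝ) :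
    t < arrival ξ (firstAfter ξ t) := by
  obtain ⟨i, hi⟩ := (h.2.eventually_gt_atTop t).exists
  exact Nat.sInf_mem (s := {i | t < arrival ξ i}) ⟨i, hi⟩

theorem firstAfter_eq {ξ : ℕ → ℝ × Angle} {t : ℝ} {k : ℕ} (hk : t < arrival ξ k)
    (h : ∀ i < k, arrival ξ i ≤ t) : firstAfter ξ t = k := by
  apply le_antisymm (Nat.sInf_le hk)
  by_contra! hlt
  exact absurd (Nat.sInf_mem (s := {i | t < arrival ξ i}) ⟨k, hk⟩) (not_lt.2 (h _ hlt))

/-- Generation times increase, so `firstAfter ξ t` is also the number of targets generated up to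
time `t`. It serves as the counting process throughout. -/
theorem Regular.lt_firstAfter_iff {ξ : ℕ → ℝ × Angle} (h : Regular ξ) {t : ℝ} {i : ℕ} :
    i < firstAfter ξ t ↔ arrival ξ i ≤ t := by
  refine ⟨arrival_le_of_lt_firstAfter, fun hi => ?_⟩
  by_contra! hle
  exact absurd (h.strictMono.monotone hle) (not_le.2 (hi.trans_lt (h.lt_arrival_firstAfter t)))

theorem Regular.firstAfter_mono {ξ : ℕ → ℝ × Angle} (h : Regular ξ) {s t : ℝ} (hst : s ≤ t) :
    firstAfter ξ s ≤ firstAfter ξ t := by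
  by_contra! hlt
  exact absurd (h.lt_firstAfter_iff.1 hlt)
    (not_le.2 (hst.trans_lt (h.lt_arrival_firstAfter t)))

theorem arrival_congr {ξ ζ : ℕ → ℝ × Angle} {i : ℕ} (h : ∀ j ≤ i, ζ j = ξ j) :
    arrival ζ i = arrival ξ i :=
  Finset.sum_congr rfl fun j hj => by rw [h j (by simpa [Nat.lt_succ_iff] using hj)]

theorem overwrite_of_lt {k i : ℕ} (h : i < k) (ξ η : ℕ → ℝ × Angle) : overwrite k ξ η i = ξ i :=
  if_pos h

theorem overwrite_add (k i : ℕ) (ξ η : ℕ → ℝ × Angle) : overwrite k ξ η (k + i) = η i := by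
  simp [overwrite]

theorem arrival_overwrite_of_lt {k i : ℕ} (h : i < k) (ξ η : ℕ → ℝ × Angle) :
    arrival (overwrite k ξ η) i = arrival ξ i :=
  arrival_congr fun _ hj => overwrite_of_lt (hj.trans_lt h) _ _

theorem arrival_overwrite_add (k i : ℕ) (ξ η : ℕ → ℝ × Angle) :
    arrival (overwrite k ξ η) (k + i) = ∑ j ∈ Finset.range k, (ξ j).1 + arrival η i := by
  rw [arrival, add_assoc, Finset.sum_range_add, arrival]
  congr 1
  · exact Finset.sum_congr rfl fun j hj => by rw [overwrite_of_lt (Finset.mem_range.1 hj)]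
  · simp [overwrite_add]

theorem arrival_delay (u : ℝ) (ξ : ℕ → ℝ × Angle) (i : ℕ) :
    arrival (delay u ξ) i = u + arrival ξ i := by
  simp only [arrival, Finset.sum_range_succ', delay]
  simp
  ring

theorem delay_snd (u : ℝ) (ξ : ℕ → ℝ × Angle) (i : ℕ) : (delay u ξ i).2 = (ξ i).2 := by
  rcases i with _ | i <;> simp [delay]

theorem arrival_splice_of_lt {t : ℝ} {ξ : ℕ → ℝ × Angle} {i : ℕ} (h : i < firstAfter ξ t)
    (η : ℕ → ℝ × Angle) : arrival (splice t ξ η) i = arrival ξ i :=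
  arrival_overwrite_of_lt h _ _

theorem arrival_splice_add (t : ℝ) (ξ η : ℕ → ℝ × Angle) (i : ℕ) :
    arrival (splice t ξ η) (firstAfter ξ t + i) = t + arrival η i := by
  rw [splice, arrival_overwrite_add, arrival_delay]; ring

theorem splice_of_lt {t : ℝ} {ξ : ℕ → ℝ × Angle} {i : ℕ} (h : i < firstAfter ξ t)
    (η : ℕ → ℝ × Angle) : splice t ξ η i = ξ i :=
  overwrite_of_lt h _ _

theorem splice_add_snd (t : ℝ) (ξ η : ℕ → ℝ × Angle) (i : ℕ) :
    (splice t ξ η (firstAfter ξ t + i)).2 = (η i).2 := by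
  rw [splice, overwrite_add, delay_snd]

theorem Regular.firstAfter_splice {ξ η : ℕ → ℝ × Angle} (hη : Regular η)
    (t : ℝ) : firstAfter (splice t ξ η) t = firstAfter ξ t := by
  refine firstAfter_eq ?_ fun i hi => ?_
  · have := arrival_splice_add t ξ η 0
    rw [add_zero] at this
    rw [this]
    linarith [hη.arrival_pos 0]
  · rw [arrival_splice_of_lt hi]
    exact arrival_le_of_lt_firstAfter hi

theorem sum_le_of_firstAfter {t : ℝ} (ht : 0 ≤ t) (ξ : ℕ → ℝ × Angle) :
    ∑ j ∈ Finset.range (firstAfter ξ t), (ξ j).1 ≤ t := by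
  rcases h : firstAfter ξ t with _ | k
  -- Before the first target the sum is empty; only here is `0 ≤ t` needed.
  · simpa using ht
  · exact arrival_le_of_lt_firstAfter (t := t) (by omega)

theorem regular_delay {u : ℝ} (hu : 0 ≤ u) {η : ℕ → ℝ × Angle} (hη : Regular η) :
    Regular (delay u η) := by
  refine ⟨fun i => ?_, ?_⟩
  · rcases i with _ | i
    · simpa [delay] using add_pos_of_nonneg_of_pos hu (hη.1 0)
    · simpa [delay] using hη.1 (i + 1)
  · simp only [funext (arrival_delay u η)]
    exact tendsto_atTop_add_const_left _ _ hη.2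

theorem regular_overwrite {k : ℕ} {ξ η : ℕ → ℝ × Angle} (hξ : ∀ i < k, 0 < (ξ i).1)
    (hη : Regular η) : Regular (overwrite k ξ η) := by
  refine ⟨fun i => ?_, ?_⟩
  · by_cases h : i < k
    · rw [overwrite_of_lt h]; exact hξ i h
    · obtain ⟨j, rfl⟩ := Nat.exists_eq_add_of_le (not_lt.1 h)
      rw [overwrite_add]; exact hη.1 j
  · rw [← tendsto_add_atTop_iff_nat k]
    have : (fun i => arrival (overwrite k ξ η) (i + k)) =
        fun i => ∑ j ∈ Finset.range k, (ξ j).1 + arrival η i := by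
      ext i; rw [add_comm, arrival_overwrite_add]
    rw [this]
    exact tendsto_atTop_add_const_left _ _ hη.2

theorem Regular.splice {ξ η : ℕ → ℝ × Angle} (hξ : Regular ξ) (hη : Regular η) {t : ℝ}
    (ht : 0 ≤ t) : Regular (splice t ξ η) :=
  regular_overwrite (fun i _ => hξ.1 i)
    (regular_delay (sub_nonneg.2 (sum_le_of_firstAfter ht ξ)) hη)

/-! ### Measurability -/

@[fun_prop]
theorem measurable_arrival (i : ℕ) : Measurable fun ξ => arrival ξ i := by
  unfold arrival; fun_prop

theorem measurable_firstAfter {α : Type*} [MeasurableSpace α] {ξ : α → ℕ → ℝ × Angle} {t : α → ℝ}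
    (hξ : Measurable ξ) (ht : Measurable t) : Measurable fun x => firstAfter (ξ x) (t x) := by
  refine measurable_to_countable' fun k => ?_
  have hm : ∀ i, MeasurableSet {x | t x < arrival (ξ x) i} := fun i =>
    measurableSet_lt ht ((measurable_arrival i).comp hξ)
  have : (fun x => firstAfter (ξ x) (t x)) ⁻¹' {k} =
      ({x | t x < arrival (ξ x) k} ∩ ⋂ i < k, {x | t x < arrival (ξ x) i}ᶜ) ∪
        -- If no target comes after time `t`, the infimum of the empty set is `0`, which enlarges
        -- the preimage of `0`.
        {x | k = 0 ∧ ∀ i, x ∈ {x | t x < arrival (ξ x) i}ᶜ} := by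
    ext x
    simp only [Set.mem_preimage, Set.mem_singleton_iff, Set.mem_union, Set.mem_inter_iff,
      Set.mem_ofPred_eq, Set.mem_iInter, Set.mem_compl_iff, not_lt]
    constructor
    · rintro rfl
      by_cases h : ∃ i, t x < arrival (ξ x) i
      · exact .inl ⟨Nat.sInf_mem (s := {i | t x < arrival (ξ x) i}) h,
          fun i hi => arrival_le_of_lt_firstAfter hi⟩
      · push Not at h
        refine .inr ⟨?_, h⟩
        have : {i | t x < arrival (ξ x) i} = ∅ := by
          ext i; simpa using h i
        rw [firstAfter, this, Nat.sInf_empty]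
    · rintro (⟨h, h'⟩ | ⟨rfl, h⟩)
      · exact firstAfter_eq h h'
      · have : {i | t x < arrival (ξ x) i} = ∅ := by
          ext i; simpa using h i
        rw [firstAfter, this, Nat.sInf_empty]
  rw [this]
  refine ((hm k).inter (MeasurableSet.biInter (Set.to_countable _) fun i _ => (hm i).compl)).union ?_
  by_cases hk : k = 0
  · simp only [hk, true_and, Set.ofPred_forall]
    exact MeasurableSet.iInter fun i => (hm i).compl
  · simp [hk]

theorem measurable_overwrite (k : ℕ) :
    Measurable fun x : (ℕ → ℝ × Angle) × (ℕ → ℝ × Angle) => overwrite k x.1 x.2 := by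
  refine measurable_pi_lambda _ fun i => ?_
  by_cases h : i < k
  · simp only [overwrite, h, if_true]; fun_prop
  · simp only [overwrite, h, if_false]; fun_prop

theorem measurable_delay (u : ℝ) : Measurable (delay u) := by
  refine measurable_pi_lambda _ fun i => ?_
  rcases i with _ | i
  · simp only [delay, Function.update_self]; fun_prop
  · simp only [delay, ne_eq, Nat.add_eq_zero_iff, one_ne_zero, and_false, not_false_eq_true,
      Function.update_of_ne]
    fun_prop

/-! ### Independent marks and the strong Markov property -/

/-- The law of the sequence of interarrival times and angles. -/
noncomputable def seqLaw (ν : Measure (ℝ × Angle)) [IsProbabilityMeasure ν] :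
    Measure (ℕ → ℝ × Angle) := Measure.infinitePi fun _ => ν

instance (ν : Measure (ℝ × Angle)) [IsProbabilityMeasure ν] : IsProbabilityMeasure (seqLaw ν) := by
  unfold seqLaw; infer_instance

/-- The first coordinate is memoryless, and independent of the second one. -/
def Memoryless (ν : Measure (ℝ × Angle)) : Prop :=
  ∀ u, 0 ≤ u → ∀ f : ℝ × Angle → ℝ≥0∞, Measurable f →
    ∫⁻ e, {e : ℝ × Angle | u < e.1}.indicator f e ∂ν =
      ν {e | u < e.1} * ∫⁻ e, f (u + e.1, e.2) ∂ν

section Law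

variable {ν : Measure (ℝ × Angle)} [IsProbabilityMeasure ν]

/-- A product measure is determined by boxes. The preimage of a box splits into a box in the first
`k` entries of `ξ` and one in the shifted entries of `η`, and the weights multiply. -/
theorem map_overwrite (k : ℕ) :
    ((seqLaw ν).prod (seqLaw ν)).map (fun x => overwrite k x.1 x.2) = seqLaw ν := by
  refine Measure.eq_infinitePi _ fun s t ht => ?_
  rw [Measure.map_apply (measurable_overwrite k)
    (MeasurableSet.pi s.countable_toSet fun i _ => ht i)]
  have : (fun x : (ℕ → ℝ × Angle) × (ℕ → ℝ × Angle) => overwrite k x.1 x.2) ⁻¹'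
      ((s : Set ℕ).pi t) =
      (((s.filter (· < k) : Finset ℕ) : Set ℕ).pi t) ×ˢ
        ((((s.filter (k ≤ ·)).image (· - k) : Finset ℕ) : Set ℕ).pi fun i => t (k + i)) := by
    ext ⟨ξ, η⟩
    simp only [Set.mem_preimage, Set.mem_pi, Finset.mem_coe, Set.mem_prod, Finset.mem_filter,
      Finset.mem_image, and_imp, forall_exists_index]
    constructor
    · intro h
      refine ⟨fun i hi hk => ?_, ?_⟩
      · simpa [overwrite, hk] using h i hi
      · rintro _ i hi hk rfl
        have := h i hi
        rw [show k + (i - k) = i by omega]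
        simpa [overwrite, not_lt.2 hk] using this
    · rintro ⟨h1, h2⟩ i hi
      by_cases hk : i < k
      · simpa [overwrite, hk] using h1 i hi hk
      · have := h2 (i - k) i hi (not_lt.1 hk) rfl
        rw [show k + (i - k) = i by omega] at this
        simpa [overwrite, hk] using this
  rw [this, Measure.prod_prod, seqLaw,
    Measure.infinitePi_pi _ (fun i _ => ht i), Measure.infinitePi_pi _ (fun i _ => ht _),
    Finset.prod_image (by
      intro i hi j hj hij
      simp only [Finset.coe_filter, Set.mem_ofPred_eq] at hi hj
      simp only at hij
      omega)]
  rw [← Finset.prod_filter_mul_prod_filter_not s (· < k)]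
  congr 1
  simp only [not_lt]
  refine Finset.prod_congr rfl fun i hi => ?_
  rw [show k + (i - k) = i by simp only [Finset.mem_filter] at hi; omega]

theorem lintegral_overwrite (k : ℕ) {f : (ℕ → ℝ × Angle) → ℝ≥0∞} (hf : Measurable f) :
    ∫⁻ ξ, f ξ ∂seqLaw ν = ∫⁻ ξ, ∫⁻ η, f (overwrite k ξ η) ∂seqLaw ν ∂seqLaw ν := by
  conv_lhs => rw [← map_overwrite (ν := ν) k]
  rw [lintegral_map hf (measurable_overwrite k)]
  exact lintegral_prod _ (hf.comp (measurable_overwrite k)).aemeasurable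

theorem lintegral_eval (i : ℕ) {f : ℝ × Angle → ℝ≥0∞} (hf : Measurable f) :
    ∫⁻ ξ, f (ξ i) ∂seqLaw ν = ∫⁻ e, f e ∂ν := by
  have h := Measure.infinitePi_map_eval (fun _ : ℕ => ν) i
  conv_rhs => rw [← h]
  rw [lintegral_map hf (by fun_prop)]
  rfl

theorem lintegral_cons {f : (ℕ → ℝ × Angle) → ℝ≥0∞} (hf : Measurable f) :
    ∫⁻ ξ, f ξ ∂seqLaw ν = ∫⁻ e, ∫⁻ η, f (overwrite 1 (fun _ => e) η) ∂seqLaw ν ∂ν := by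
  have hm : Measurable fun e : ℝ × Angle => ∫⁻ η, f (overwrite 1 (fun _ => e) η) ∂seqLaw ν := by
    refine Measurable.lintegral_prod_right'
      (f := fun x : (ℝ × Angle) × (ℕ → ℝ × Angle) => f (overwrite 1 (fun _ => x.1) x.2)) ?_
    exact hf.comp ((measurable_overwrite 1).comp
      ((measurable_pi_lambda _ fun _ => measurable_fst).prodMk measurable_snd))
  rw [lintegral_overwrite 1 hf, ← lintegral_eval 0 hm]
  refine lintegral_congr fun ξ => lintegral_congr fun η => ?_
  congr 1
  ext i : 1
  by_cases hi : i < 1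
  · obtain rfl : i = 0 := by omega
    simp [overwrite]
  · simp [overwrite, hi]

/-- All entries but the first are independent of it, so integrating them out reduces the claim to
memorylessness of a single mark. -/
theorem Memoryless.lintegral_seq (hν : Memoryless ν) {u : ℝ} (hu : 0 ≤ u)
    {f : (ℕ → ℝ × Angle) → ℝ≥0∞} (hf : Measurable f) :
    ∫⁻ ξ, {ξ : ℕ → ℝ × Angle | u < (ξ 0).1}.indicator f ξ ∂seqLaw ν =
      seqLaw ν {ξ | u < (ξ 0).1} * ∫⁻ ξ, f (delay u ξ) ∂seqLaw ν := by
  have hset : MeasurableSet {ξ : ℕ → ℝ × Angle | u < (ξ 0).1} :=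
    measurableSet_lt measurable_const (by fun_prop)
  have hset' : MeasurableSet {e : ℝ × Angle | u < e.1} :=
    measurableSet_lt measurable_const (by fun_prop)
  have hm : Measurable fun e : ℝ × Angle => ∫⁻ η, f (overwrite 1 (fun _ => e) η) ∂seqLaw ν := by
    refine Measurable.lintegral_prod_right'
      (f := fun x : (ℝ × Angle) × (ℕ → ℝ × Angle) => f (overwrite 1 (fun _ => x.1) x.2)) ?_
    exact hf.comp ((measurable_overwrite 1).comp
      ((measurable_pi_lambda _ fun _ => measurable_fst).prodMk measurable_snd))
  have hP : seqLaw ν {ξ | u < (ξ 0).1} = ν {e | u < e.1} := by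
    rw [← lintegral_indicator_one hset, ← lintegral_indicator_one hset',
      ← lintegral_eval 0 (measurable_one.indicator hset')]
    rfl
  have hd : ∀ e η, delay u (overwrite 1 (fun _ => e) η) =
      overwrite 1 (fun _ => (u + e.1, e.2)) η := fun e η => by
    ext i : 1
    rcases i with _ | i <;> simp [delay, overwrite]
  have hc := lintegral_cons (ν := ν) (hf.comp (measurable_delay u))
  simp only [Function.comp_def, hd] at hc
  rw [lintegral_cons (hf.indicator hset), hc, hP, ← hν u hu _ hm]
  refine lintegral_congr fun e => ?_
  by_cases he : u < e.1
  · simp [Set.indicator, he, overwrite]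
  · simp [Set.indicator, he, overwrite]

end Law

/-- The value of `σ` depends only on the targets generated up to the time `σ`. -/
def IsStopping (σ : (ℕ → ℝ × Angle) → ℝ) : Prop :=
  ∀ ξ ζ, Regular ξ → Regular ζ → (∀ i < firstAfter ξ (σ ξ), ζ i = ξ i) →
    σ ξ < arrival ζ (firstAfter ξ (σ ξ)) → σ ζ = σ ξ

theorem overwrite_overwrite (k : ℕ) (ξ η η' : ℕ → ℝ × Angle) :
    overwrite k (overwrite k ξ η) η' = overwrite k ξ η' := by
  ext i : 1
  by_cases h : i < k <;> simp [overwrite, h]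

theorem sum_overwrite (k : ℕ) (ξ η : ℕ → ℝ × Angle) :
    ∑ j ∈ Finset.range k, (overwrite k ξ η j).1 = ∑ j ∈ Finset.range k, (ξ j).1 :=
  Finset.sum_congr rfl fun j hj => by rw [overwrite_of_lt (Finset.mem_range.1 hj)]

theorem arrival_overwrite_self (k : ℕ) (ξ η : ℕ → ℝ × Angle) :
    arrival (overwrite k ξ η) k = ∑ j ∈ Finset.range k, (ξ j).1 + (η 0).1 := by
  have := arrival_overwrite_add k 0 ξ η
  rw [add_zero] at this
  rw [this]
  simp [arrival]

section Markov

variable {ν : Measure (ℝ × Angle)} [IsProbabilityMeasure ν] {σ : (ℕ → ℝ × Angle) → ℝ}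

/-- This is the strong Markov property with the first `k` marks frozen, on the event that exactly
`k` targets come up to time `σ`. If some continuation lies in the event, the stopping property
forces one common value `t` of `σ` there and makes the event equal to `t - S < (η 0).1`.
Conditioning on this is harmless by memorylessness. -/
theorem IsStopping.lintegral_firstAfter_eq (hν : Memoryless ν)
    (hreg : ∀ᵐ ξ ∂seqLaw ν, Regular ξ) (hσ : IsStopping σ) (h0 : ∀ ξ, Regular ξ → 0 ≤ σ ξ)
    {f : (ℕ → ℝ × Angle) → ℝ≥0∞} (hf : Measurable f) (k : ℕ) {ξ : ℕ → ℝ × Angle}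
    (hξ : Regular ξ) :
    ∫⁻ η, {ζ | firstAfter ζ (σ ζ) = k}.indicator f (overwrite k ξ η) ∂seqLaw ν =
      ∫⁻ η, {ζ | firstAfter ζ (σ ζ) = k}.indicator (fun ζ => ∫⁻ η', f (overwrite k ζ
        (delay (σ ζ - ∑ j ∈ Finset.range k, (ζ j).1) η')) ∂seqLaw ν) (overwrite k ξ η)
        ∂seqLaw ν := by
  set A : Set (ℕ → ℝ × Angle) := {ζ | firstAfter ζ (σ ζ) = k} with hA
  set S : ℝ := ∑ j ∈ Finset.range k, (ξ j).1 with hS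
  have hO : ∀ {η}, Regular η → Regular (overwrite k ξ η) := fun hη =>
    regular_overwrite (fun i _ => hξ.1 i) hη
  -- Two continuations of the same first `k` marks look alike up to time `σ` as soon as the next
  -- target of each comes later than that, so they share the value of `σ` and the event.
  have transfer : ∀ {η η'}, Regular η → Regular η' → overwrite k ξ η ∈ A →
      σ (overwrite k ξ η) < S + (η' 0).1 →
      σ (overwrite k ξ η') = σ (overwrite k ξ η) ∧ overwrite k ξ η' ∈ A := by
    intro η η' hη hη' hmem hlt
    have hk : firstAfter (overwrite k ξ η) (σ (overwrite k ξ η)) = k := hmem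
    have h1 : σ (overwrite k ξ η') = σ (overwrite k ξ η) := by
      refine hσ _ _ (hO hη) (hO hη') (fun i hi => ?_) ?_
      · rw [hk] at hi
        rw [overwrite_of_lt hi, overwrite_of_lt hi]
      · rw [hk, arrival_overwrite_self]
        exact hlt
    refine ⟨h1, ?_⟩
    change firstAfter _ _ = k
    rw [h1]
    refine firstAfter_eq ?_ fun i hi => ?_
    · rw [arrival_overwrite_self]
      exact hlt
    · rw [arrival_overwrite_of_lt hi, ← arrival_overwrite_of_lt hi ξ η]
      rw [← hk] at hi
      exact arrival_le_of_lt_firstAfter hi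
  by_cases hex : ∃ η, Regular η ∧ overwrite k ξ η ∈ A
  · obtain ⟨η₀, hη₀, hmem⟩ := hex
    have hk₀ : firstAfter (overwrite k ξ η₀) (σ (overwrite k ξ η₀)) = k := hmem
    set t := σ (overwrite k ξ η₀) with ht
    have hu : 0 ≤ t - S := by
      have := sum_le_of_firstAfter (h0 _ (hO hη₀)) (overwrite k ξ η₀)
      rw [hk₀, sum_overwrite] at this
      linarith
    have hlt₀ : t < S + (η₀ 0).1 := by
      have := (hO hη₀).lt_arrival_firstAfter t
      rwa [hk₀, arrival_overwrite_self] at this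
    have key : ∀ η, Regular η → (overwrite k ξ η ∈ A ↔ t - S < (η 0).1) := by
      intro η hη
      refine ⟨fun h => ?_, fun h => (transfer hη₀ hη hmem (by linarith)).2⟩
      have hlt : σ (overwrite k ξ η) < S + (η 0).1 := by
        have := (hO hη).lt_arrival_firstAfter (σ (overwrite k ξ η))
        have hk : firstAfter (overwrite k ξ η) (σ (overwrite k ξ η)) = k := h
        rwa [hk, arrival_overwrite_self] at this
      -- Otherwise `σ` at `η` is less than `t`, hence also before the next target of `η₀`;
      -- transferring to `η₀` would make it equal to `t`.
      by_contra! hle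
      have := (transfer hη hη₀ h (by linarith)).1
      linarith
    have hval : ∀ η, Regular η → t - S < (η 0).1 → σ (overwrite k ξ η) = t := fun η hη h =>
      (transfer hη₀ hη hmem (by linarith)).1
    have hset : MeasurableSet {ξ : ℕ → ℝ × Angle | t - S < (ξ 0).1} :=
      measurableSet_lt measurable_const (by fun_prop)
    have hfm : Measurable fun η => f (overwrite k ξ η) :=
      hf.comp ((measurable_overwrite k).comp (measurable_const.prodMk measurable_id))
    have hL : ∫⁻ η, A.indicator f (overwrite k ξ η) ∂seqLaw ν =
        ∫⁻ η, {η : ℕ → ℝ × Angle | t - S < (η 0).1}.indicator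
          (fun η => f (overwrite k ξ η)) η ∂seqLaw ν := by
      refine lintegral_congr_ae ?_
      filter_upwards [hreg] with η hη
      have := key η hη
      by_cases h : t - S < (η 0).1
      · simp [h, this.2 h]
      · simp [h, mt this.1 h]
    have hR : ∫⁻ η, A.indicator (fun ζ => ∫⁻ η', f (overwrite k ζ
        (delay (σ ζ - ∑ j ∈ Finset.range k, (ζ j).1) η')) ∂seqLaw ν) (overwrite k ξ η)
        ∂seqLaw ν =
        ∫⁻ η, {η : ℕ → ℝ × Angle | t - S < (η 0).1}.indicator
          (fun _ => ∫⁻ η', f (overwrite k ξ (delay (t - S) η')) ∂seqLaw ν) η ∂seqLaw ν := by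
      refine lintegral_congr_ae ?_
      filter_upwards [hreg] with η hη
      have := key η hη
      by_cases h : t - S < (η 0).1
      · rw [Set.indicator_of_mem (this.2 h), Set.indicator_of_mem (Set.mem_ofPred_eq ▸ h)]
        simp only [overwrite_overwrite, sum_overwrite, hval η hη h, ← hS]
      · simp [h, mt this.1 h]
    rw [hL, hR, hν.lintegral_seq hu hfm, lintegral_indicator_const hset, mul_comm]
  -- No regular continuation lies in the event, and both sides vanish.
  · push Not at hex
    have hz : ∀ g : (ℕ → ℝ × Angle) → ℝ≥0∞,
        ∫⁻ η, A.indicator g (overwrite k ξ η) ∂seqLaw ν = 0 := by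
      intro g
      rw [lintegral_congr_ae (g := fun _ => 0), lintegral_zero]
      filter_upwards [hreg] with η hη
      simp [hex η hη]
    rw [hz, hz]

/-- The strong Markov property: after a stopping time, the process may be replaced by a fresh
copy. -/
theorem IsStopping.lintegral_splice (hν : Memoryless ν)
    (hreg : ∀ᵐ ξ ∂seqLaw ν, Regular ξ) (hσm : Measurable σ) (hσ : IsStopping σ)
    (h0 : ∀ ξ, Regular ξ → 0 ≤ σ ξ) {f : (ℕ → ℝ × Angle) → ℝ≥0∞} (hf : Measurable f) :
    ∫⁻ ξ, f ξ ∂seqLaw ν = ∫⁻ ξ, ∫⁻ η, f (splice (σ ξ) ξ η) ∂seqLaw ν ∂seqLaw ν := by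
  have hAm : ∀ k, MeasurableSet {ξ | firstAfter ξ (σ ξ) = k} := fun k =>
    measurable_firstAfter measurable_id hσm (measurableSet_singleton k)
  have hU : ⋃ k, {ξ | firstAfter ξ (σ ξ) = k} = Set.univ := by
    ext ξ; simp
  have hdisj : Pairwise (Function.onFun Disjoint fun k => {ξ | firstAfter ξ (σ ξ) = k}) := by
    intro i j hij
    refine Set.disjoint_left.2 fun ξ hi hj => hij ?_
    exact (show firstAfter ξ (σ ξ) = i from hi).symm.trans hj
  have hg : ∀ k, Measurable fun ζ : ℕ → ℝ × Angle => ∫⁻ η', f (overwrite k ζ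
      (delay (σ ζ - ∑ j ∈ Finset.range k, (ζ j).1) η')) ∂seqLaw ν := by
    intro k
    refine Measurable.lintegral_prod_right' (f := fun x : (ℕ → ℝ × Angle) × (ℕ → ℝ × Angle) =>
      f (overwrite k x.1 (delay (σ x.1 - ∑ j ∈ Finset.range k, (x.1 j).1) x.2))) ?_
    have hd : Measurable fun x : (ℕ → ℝ × Angle) × (ℕ → ℝ × Angle) =>
        delay (σ x.1 - ∑ j ∈ Finset.range k, (x.1 j).1) x.2 := ?_
    · exact hf.comp ((measurable_overwrite k).comp (measurable_fst.prodMk hd))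
    refine measurable_pi_lambda _ fun i => ?_
    rcases i with _ | i
    · simp only [delay, Function.update_self]; fun_prop
    · simp only [delay, ne_eq, Nat.add_eq_zero_iff, one_ne_zero, and_false, not_false_eq_true,
        Function.update_of_ne]
      fun_prop
  -- The space is partitioned by the number `k` of targets generated up to time `σ`.
  rw [← setLIntegral_univ, ← hU, lintegral_iUnion hAm hdisj, ← setLIntegral_univ (fun ξ => _),
    ← hU, lintegral_iUnion hAm hdisj]
  congr 1
  ext k
  have hR : ∫⁻ ξ in {ξ | firstAfter ξ (σ ξ) = k}, ∫⁻ η, f (splice (σ ξ) ξ η) ∂seqLaw ν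
      ∂seqLaw ν = ∫⁻ ξ in {ξ | firstAfter ξ (σ ξ) = k}, ∫⁻ η', f (overwrite k ξ
      (delay (σ ξ - ∑ j ∈ Finset.range k, (ξ j).1) η')) ∂seqLaw ν ∂seqLaw ν := by
    refine setLIntegral_congr_fun (hAm k) fun ξ hξ => ?_
    have hk : firstAfter ξ (σ ξ) = k := hξ
    simp only [splice, hk]
  -- On each piece the entries from index `k` on are resampled, which exposes an inner integral over
  -- continuations of fixed first `k` marks.
  rw [hR, ← lintegral_indicator (hAm k), ← lintegral_indicator (hAm k),
    lintegral_overwrite k (hf.indicator (hAm k)), lintegral_overwrite k ((hg k).indicator (hAm k))]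
  refine lintegral_congr_ae ?_
  filter_upwards [hreg] with ξ hξ
  exact hσ.lintegral_firstAfter_eq hν hreg h0 hf k hξ

theorem isStopping_const (t : ℝ) : IsStopping fun _ => t := fun _ _ _ _ _ _ => rfl

theorem lintegral_splice_const (hν : Memoryless ν) (hreg : ∀ᵐ ξ ∂seqLaw ν, Regular ξ) {t : ℝ}
    (ht : 0 ≤ t) {f : (ℕ → ℝ × Angle) → ℝ≥0∞} (hf : Measurable f) :
    ∫⁻ ξ, f ξ ∂seqLaw ν = ∫⁻ ξ, ∫⁻ η, f (splice t ξ η) ∂seqLaw ν ∂seqLaw ν :=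
  (isStopping_const t).lintegral_splice hν hreg measurable_const (fun _ _ => ht) hf

end Markov

/-! ### Exponential interarrival times -/

theorem lintegral_expMeasure {lam : ℝ} {f : ℝ → ℝ≥0∞} (hf : Measurable f) :
    ∫⁻ x, f x ∂expMeasure lam = ∫⁻ x, gammaPDF 1 lam x * f x := by
  have hm : Measurable (gammaPDF 1 lam) := (measurable_gammaPDFReal 1 lam).ennreal_ofReal
  rw [expMeasure, gammaMeasure, lintegral_withDensity_eq_lintegral_mul _ hm hf]
  rfl

theorem gammaPDF_one_add {lam u x : ℝ} (hu : 0 ≤ u) (hx : 0 < x) :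
    gammaPDF 1 lam (u + x) = ENNReal.ofReal (Real.exp (-(lam * u))) * gammaPDF 1 lam x := by
  rw [gammaPDF_of_nonneg hx.le, gammaPDF_of_nonneg (by positivity),
    ← ENNReal.ofReal_mul (Real.exp_nonneg _)]
  congr 1
  simp only [sub_self, Real.rpow_zero, Real.rpow_one, Real.Gamma_one]
  rw [show -(lam * (u + x)) = -(lam * u) + -(lam * x) by ring, Real.exp_add]
  ring

theorem lintegral_expMeasure_indicator {lam u : ℝ} (hu : 0 ≤ u) {f : ℝ → ℝ≥0∞}
    (hf : Measurable f) :
    ∫⁻ x, (Set.Ioi u).indicator f x ∂expMeasure lam =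
      ENNReal.ofReal (Real.exp (-(lam * u))) * ∫⁻ x, f (u + x) ∂expMeasure lam := by
  rw [lintegral_expMeasure (hf.indicator measurableSet_Ioi),
    lintegral_expMeasure (f := fun x => f (u + x)) (by fun_prop),
    ← lintegral_const_mul' _ _ ENNReal.ofReal_ne_top,
    ← lintegral_add_left_eq_self _ u]
  refine lintegral_congr_ae ?_
  -- At `x = 0` the integrands may differ, because the indicator of `Ioi u` vanishes at `u` while
  -- the density need not vanish at `0`. A single point is null.
  filter_upwards [compl_mem_ae_iff.2 (measure_singleton (0 : ℝ))] with x hx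
  rcases lt_trichotomy x 0 with h | h | h
  · rw [gammaPDF_of_neg h]
    simp [h.le]
  · exact absurd h hx
  · rw [gammaPDF_one_add hu h]
    simp [h, mul_assoc]

/-- Multiplying the exponential density by `x` gives `1 / lam` times the gamma density of shape `2`,
whose total mass is one. -/
theorem lintegral_ofReal_expMeasure {lam : ℝ} (hlam : 0 < lam) :
    ∫⁻ x, ENNReal.ofReal x ∂expMeasure lam = ENNReal.ofReal (1 / lam) := by
  rw [lintegral_expMeasure (by fun_prop)]
  have : ∀ x, gammaPDF 1 lam x * ENNReal.ofReal x =
      ENNReal.ofReal (1 / lam) * gammaPDF 2 lam x := by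
    intro x
    rcases lt_or_ge x 0 with h | h
    · simp [gammaPDF_of_neg h]
    · rw [gammaPDF_of_nonneg h, gammaPDF_of_nonneg h, ← ENNReal.ofReal_mul (by positivity),
        ← ENNReal.ofReal_mul (by positivity)]
      congr 1
      have h2 : Real.Gamma 2 = 1 := Real.Gamma_two
      rw [h2]
      simp only [sub_self, Real.rpow_zero, Real.rpow_one, Real.Gamma_one]
      rw [show (2 : ℝ) - 1 = 1 by norm_num, Real.rpow_one, Real.rpow_two]
      field_simp
  simp_rw [this]
  rw [lintegral_const_mul' _ _ ENNReal.ofReal_ne_top,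
    lintegral_gammaPDF_eq_one two_pos hlam, mul_one]

/-- The joint law of an interarrival time and an angle. -/
noncomputable def markLaw (lam : ℝ) : Measure (ℝ × Angle) :=
  (expMeasure lam).prod AddCircle.haarAddCircle

theorem isProbabilityMeasure_markLaw {lam : ℝ} (hlam : 0 < lam) :
    IsProbabilityMeasure (markLaw lam) := by
  have := isProbabilityMeasure_expMeasure hlam
  unfold markLaw
  infer_instance

theorem lintegral_markLaw_fst {lam : ℝ} (hlam : 0 < lam) {f : ℝ → ℝ≥0∞} (hf : Measurable f) :
    ∫⁻ e, f e.1 ∂markLaw lam = ∫⁻ x, f x ∂expMeasure lam := by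
  have := isProbabilityMeasure_expMeasure hlam
  rw [markLaw, lintegral_prod _ (by fun_prop)]
  simp

theorem memoryless_markLaw {lam : ℝ} (hlam : 0 < lam) : Memoryless (markLaw lam) := by
  have := isProbabilityMeasure_expMeasure hlam
  intro u hu f hf
  have hset : MeasurableSet {e : ℝ × Angle | u < e.1} :=
    measurableSet_lt measurable_const (by fun_prop)
  have h1 : markLaw lam {e | u < e.1} = ENNReal.ofReal (Real.exp (-(lam * u))) := by
    have : markLaw lam {e | u < e.1} = ∫⁻ x, (Set.Ioi u).indicator (fun _ => 1) x
        ∂expMeasure lam := by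
      rw [← lintegral_indicator_one hset,
        ← lintegral_markLaw_fst hlam (measurable_const.indicator measurableSet_Ioi)]
      rfl
    rw [this, lintegral_expMeasure_indicator hu measurable_const]
    simp
  rw [h1, markLaw, lintegral_prod_symm _ (hf.indicator hset).aemeasurable,
    lintegral_prod_symm _ (by fun_prop), ← lintegral_const_mul' _ _ ENNReal.ofReal_ne_top]
  refine lintegral_congr fun θ => ?_
  rw [← lintegral_expMeasure_indicator hu (f := fun x => f (x, θ)) (by fun_prop)]
  rfl

theorem markLaw_nonpos {lam : ℝ} (hlam : 0 < lam) : ∀ᵐ e ∂markLaw lam, 0 < e.1 := by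
  have := isProbabilityMeasure_markLaw hlam
  have h := (memoryless_markLaw hlam) 0 le_rfl (fun _ => 1) measurable_const
  have := isProbabilityMeasure_expMeasure hlam
  have h2 := lintegral_expMeasure_indicator (lam := lam) le_rfl (f := fun _ => 1) measurable_const
  have hset : MeasurableSet {e : ℝ × Angle | 0 < e.1} :=
    measurableSet_lt measurable_const (by fun_prop)
  have h3 := lintegral_markLaw_fst hlam
    ((measurable_const (a := (1 : ℝ≥0∞))).indicator (measurableSet_Ioi (a := (0 : ℝ))))
  rw [h2] at h3
  have h4 : markLaw lam {e | 0 < e.1} = 1 := by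
    rw [← lintegral_indicator_one hset]
    refine Eq.trans ?_ (h3.trans (by simp))
    rfl
  exact (prob_compl_eq_zero_iff hset).2 h4

theorem ae_seqLaw_of_ae {ν : Measure (ℝ × Angle)} [IsProbabilityMeasure ν]
    {p : ℝ × Angle → Prop} (h : ∀ᵐ e ∂ν, p e) (i : ℕ) : ∀ᵐ ξ ∂seqLaw ν, p (ξ i) :=
  (measurePreserving_eval_infinitePi (fun _ : ℕ => ν) i).quasiMeasurePreserving.ae h

section Exp

variable {lam : ℝ}

theorem lintegral_interarrival [IsProbabilityMeasure (markLaw lam)] (hlam : 0 < lam) (i : ℕ) :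
    ∫⁻ ξ, ENNReal.ofReal (ξ i).1 ∂seqLaw (markLaw lam) = ENNReal.ofReal (1 / lam) := by
  rw [lintegral_eval i (f := fun e => ENNReal.ofReal e.1) (by fun_prop),
    lintegral_markLaw_fst hlam (by fun_prop), lintegral_ofReal_expMeasure hlam]

theorem ae_pos_interarrival [IsProbabilityMeasure (markLaw lam)] (hlam : 0 < lam) :
    ∀ᵐ ξ ∂seqLaw (markLaw lam), ∀ i, 0 < (ξ i).1 :=
  ae_all_iff.2 fun i => ae_seqLaw_of_ae (markLaw_nonpos hlam) i

theorem ae_tendsto_arrival_div [IsProbabilityMeasure (markLaw lam)] (hlam : 0 < lam) :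
    ∀ᵐ ξ ∂seqLaw (markLaw lam),
      Tendsto (fun n : ℕ => (∑ i ∈ Finset.range n, (ξ i).1) / (n : ℝ)) atTop (𝓝 (1 / lam)) := by
  have hnn : ∀ i, 0 ≤ᵐ[seqLaw (markLaw lam)] fun ξ : ℕ → ℝ × Angle => (ξ i).1 := fun i => by
    filter_upwards [ae_pos_interarrival hlam] with ξ h using (h i).le
  have hmean : ∫ ξ, (ξ 0).1 ∂seqLaw (markLaw lam) = 1 / lam := by
    rw [integral_eq_lintegral_of_nonneg_ae (hnn 0)
      (Measurable.aestronglyMeasurable (by fun_prop)), lintegral_interarrival hlam,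
      ENNReal.toReal_ofReal (by positivity)]
  rw [← hmean]
  refine strong_law_ae_real (fun i (ξ : ℕ → ℝ × Angle) => (ξ i).1) ?_ ?_ ?_
  · refine ⟨Measurable.aestronglyMeasurable (by fun_prop), ?_⟩
    rw [hasFiniteIntegral_iff_ofReal (hnn 0), lintegral_interarrival hlam]
    exact ENNReal.ofReal_lt_top
  · intro i j hij
    exact (iIndepFun_infinitePi (P := fun _ : ℕ => markLaw lam)
      (X := fun _ e => e.1) (fun _ => measurable_fst)).indepFun hij
  · intro i
    refine ⟨Measurable.aemeasurable (by fun_prop), Measurable.aemeasurable (by fun_prop), ?_⟩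
    have h : ∀ i : ℕ, (seqLaw (markLaw lam)).map (fun ξ => (ξ i).1) =
        (markLaw lam).map Prod.fst := by
      intro i
      have := Measure.infinitePi_map_eval (fun _ : ℕ => markLaw lam) i
      conv_rhs => rw [← this]
      rw [Measure.map_map measurable_fst (by fun_prop)]
      rfl
    rw [h, h]

/-- Interarrival times are almost surely positive, and by the strong law their averages have a
positive limit, so the partial sums diverge. -/
theorem ae_regular [IsProbabilityMeasure (markLaw lam)] (hlam : 0 < lam) :
    ∀ᵐ ξ ∂seqLaw (markLaw lam), Regular ξ := by
  filter_upwards [ae_pos_interarrival hlam, ae_tendsto_arrival_div hlam] with ξ h1 h2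
  refine ⟨h1, ?_⟩
  have h3 : Tendsto (fun n : ℕ => (n : ℝ) * ((∑ i ∈ Finset.range n, (ξ i).1) / n)) atTop atTop :=
    tendsto_natCast_atTop_atTop.atTop_mul_pos (by positivity) h2
  have h4 := (tendsto_add_atTop_iff_nat 1).2 h3
  refine h4.congr fun n => ?_
  rw [mul_div_cancel₀ _ (by positivity)]
  rfl

end Exp

/-! ### The number of targets generated up to a given time -/

theorem Regular.le_firstAfter_iff {ξ : ℕ → ℝ × Angle} (h : Regular ξ) {t : ℝ} {i : ℕ} :
    i ≤ firstAfter ξ t ↔ ∀ j < i, arrival ξ j ≤ t := by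
  refine ⟨fun hi j hj => arrival_le_of_lt_firstAfter (hj.trans_le hi), fun hi => ?_⟩
  by_contra! hlt
  exact absurd (hi _ hlt) (not_le.2 (h.lt_arrival_firstAfter t))

/-- Wald's identity. The mean generation time of the first target after `t` is computed twice: as a
sum of gaps it is the mean number of targets up to `t`, plus one, times `1 / lam`; by the Markov
property at time `t` it is `t + 1 / lam`. -/
theorem lintegral_firstAfter {lam : ℝ} [IsProbabilityMeasure (markLaw lam)] (hlam : 0 < lam)
    {t : ℝ} (ht : 0 ≤ t) :
    ∫⁻ ξ, (firstAfter ξ t : ℝ≥0∞) ∂seqLaw (markLaw lam) = ENNReal.ofReal (lam * t) := by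
  have hreg := ae_regular hlam
  have hN : Measurable fun ξ : ℕ → ℝ × Angle => firstAfter ξ t :=
    measurable_firstAfter measurable_id measurable_const
  -- For regular `ξ` this event says that gap `i` belongs to the sum up to the first target after
  -- `t`. It depends only on the gaps before `i`, hence is independent of gap `i`.
  set p : ℕ → Set (ℕ → ℝ × Angle) := fun i => {ξ | ∀ j < i, arrival ξ j ≤ t} with hp
  have hpm : ∀ i, MeasurableSet (p i) := fun i => by
    simp only [hp, Set.ofPred_forall]
    exact MeasurableSet.biInter (Set.to_countable _) fun j _ =>
      measurableSet_le (measurable_arrival j) measurable_const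
  set F : (ℕ → ℝ × Angle) → ℝ≥0∞ :=
    fun ξ => ∑' i, (p i).indicator (fun ξ => ENNReal.ofReal (ξ i).1) ξ with hF
  have hFm : Measurable F :=
    Measurable.tsum fun i => Measurable.indicator (by fun_prop) (hpm i)
  have hFreg : ∀ ξ, Regular ξ → F ξ = ENNReal.ofReal (arrival ξ (firstAfter ξ t)) := by
    intro ξ hξ
    rw [hF, arrival, ENNReal.ofReal_sum_of_nonneg fun i _ => (hξ.1 i).le]
    simp only
    rw [tsum_eq_sum (s := Finset.range (firstAfter ξ t + 1))]
    · refine Finset.sum_congr rfl fun i hi => Set.indicator_of_mem ?_ _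
      exact hξ.le_firstAfter_iff.1 (Nat.lt_succ_iff.1 (Finset.mem_range.1 hi))
    · intro i hi
      refine Set.indicator_of_notMem (fun h => hi ?_) _
      exact Finset.mem_range.2 (Nat.lt_succ_iff.2 (hξ.le_firstAfter_iff.2 h))
  have h1 : ∫⁻ ξ, F ξ ∂seqLaw (markLaw lam) =
      (∫⁻ ξ, (firstAfter ξ t : ℝ≥0∞) ∂seqLaw (markLaw lam) + 1) * ENNReal.ofReal (1 / lam) := by
    have hi : ∀ i, ∫⁻ ξ, (p i).indicator (fun ξ => ENNReal.ofReal (ξ i).1) ξ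
        ∂seqLaw (markLaw lam) =
        seqLaw (markLaw lam) (p i) * ENNReal.ofReal (1 / lam) := by
      intro i
      rw [lintegral_overwrite i (Measurable.indicator (by fun_prop) (hpm i)),
        mul_comm (seqLaw (markLaw lam) (p i)),
        ← lintegral_indicator_const (hpm i)]
      refine lintegral_congr fun ξ => ?_
      have hmem : ∀ η, overwrite i ξ η ∈ p i ↔ ξ ∈ p i := fun η =>
        forall₂_congr fun j hj => by rw [arrival_overwrite_of_lt hj]
      by_cases h : ξ ∈ p i
      · rw [Set.indicator_of_mem h, ← lintegral_interarrival hlam 0]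
        refine lintegral_congr fun η => ?_
        rw [Set.indicator_of_mem ((hmem η).2 h)]
        simp [overwrite]
      · rw [Set.indicator_of_notMem h]
        simp [hmem, h]
    rw [hF, lintegral_tsum fun i => (Measurable.indicator (by fun_prop) (hpm i)).aemeasurable]
    simp_rw [hi]
    rw [ENNReal.tsum_mul_right]
    congr 1
    simp_rw [← lintegral_indicator_one (hpm _)]
    rw [← lintegral_tsum fun i => (measurable_one.indicator (hpm i)).aemeasurable]
    have : ∫⁻ ξ, (firstAfter ξ t : ℝ≥0∞) ∂seqLaw (markLaw lam) + 1 =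
        ∫⁻ ξ, ((firstAfter ξ t : ℝ≥0∞) + 1) ∂seqLaw (markLaw lam) := by
      rw [lintegral_add_right _ measurable_const]; simp
    rw [this]
    refine lintegral_congr_ae ?_
    filter_upwards [hreg] with ξ hξ
    rw [tsum_eq_sum (s := Finset.range (firstAfter ξ t + 1))]
    · rw [Finset.sum_congr rfl (g := fun _ => (1 : ℝ≥0∞))]
      · simp
      · intro i hi
        exact Set.indicator_of_mem (s := p i)
          (hξ.le_firstAfter_iff.1 (Nat.lt_succ_iff.1 (Finset.mem_range.1 hi))) _
    · intro i hi
      refine Set.indicator_of_notMem (fun h => hi ?_) _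
      exact Finset.mem_range.2 (Nat.lt_succ_iff.2 (hξ.le_firstAfter_iff.2 h))
  have h2 : ∫⁻ ξ, F ξ ∂seqLaw (markLaw lam) = ENNReal.ofReal t + ENNReal.ofReal (1 / lam) := by
    rw [lintegral_splice_const (memoryless_markLaw hlam) hreg ht hFm]
    have : ∀ᵐ ξ ∂seqLaw (markLaw lam),
        ∫⁻ η, F (splice t ξ η) ∂seqLaw (markLaw lam) = ENNReal.ofReal t + ENNReal.ofReal (1 / lam) := by
      filter_upwards [hreg] with ξ hξ
      rw [← lintegral_interarrival hlam 0]
      have hc : ∫⁻ η, F (splice t ξ η) ∂seqLaw (markLaw lam) =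
          ∫⁻ η, (ENNReal.ofReal t + ENNReal.ofReal (η 0).1) ∂seqLaw (markLaw lam) := by
        refine lintegral_congr_ae ?_
        filter_upwards [hreg] with η hη
        rw [hFreg _ (hξ.splice hη ht), hη.firstAfter_splice]
        have := arrival_splice_add t ξ η 0
        rw [add_zero] at this
        rw [this, ← ENNReal.ofReal_add ht (hη.1 0).le]
        simp [arrival]
      rw [hc, lintegral_add_left measurable_const]
      simp
    rw [lintegral_congr_ae this]
    simp
  have h3 := h1.symm.trans h2
  have h4 : ∫⁻ ξ, (firstAfter ξ t : ℝ≥0∞) ∂seqLaw (markLaw lam) + 1 =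
      ENNReal.ofReal (lam * t) + 1 := by
    have h5 := congrArg (fun x => x * ENNReal.ofReal lam) h3
    rw [mul_assoc, ← ENNReal.ofReal_mul (by positivity), one_div_mul_cancel hlam.ne',
      ENNReal.ofReal_one, mul_one, add_mul, ← ENNReal.ofReal_mul ht,
      ← ENNReal.ofReal_mul (by positivity), one_div_mul_cancel hlam.ne', ENNReal.ofReal_one] at h5
    rw [h5, mul_comm]
  exact (ENNReal.add_left_inj ENNReal.one_ne_top).1 h4

theorem integrable_firstAfter {lam : ℝ} [IsProbabilityMeasure (markLaw lam)] (hlam : 0 < lam)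
    (t : ℝ) : Integrable (fun ξ => (firstAfter ξ t : ℝ)) (seqLaw (markLaw lam)) := by
  have hN : ∀ t, Measurable fun ξ : ℕ → ℝ × Angle => firstAfter ξ t := fun t =>
    measurable_firstAfter measurable_id measurable_const
  have h : Integrable (fun ξ => (firstAfter ξ (max t 0) : ℝ)) (seqLaw (markLaw lam)) := by
    refine ⟨(measurable_from_nat.comp (hN _)).aestronglyMeasurable, ?_⟩
    rw [hasFiniteIntegral_iff_ofReal (ae_of_all _ fun _ => Nat.cast_nonneg _)]
    simp only [ENNReal.ofReal_natCast]
    rw [lintegral_firstAfter hlam (le_max_right _ _)]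
    exact ENNReal.ofReal_lt_top
  refine h.mono (measurable_from_nat.comp (hN _)).aestronglyMeasurable ?_
  filter_upwards [ae_regular hlam] with ξ hξ
  simpa using hξ.firstAfter_mono (le_max_left t 0)

theorem integral_firstAfter {lam : ℝ} [IsProbabilityMeasure (markLaw lam)] (hlam : 0 < lam)
    {t : ℝ} (ht : 0 ≤ t) :
    ∫ ξ, (firstAfter ξ t : ℝ) ∂seqLaw (markLaw lam) = lam * t := by
  rw [integral_eq_lintegral_of_nonneg_ae (ae_of_all _ fun _ => Nat.cast_nonneg _)
    (integrable_firstAfter hlam t).1]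
  simp only [ENNReal.ofReal_natCast]
  rw [lintegral_firstAfter hlam ht, ENNReal.toReal_ofReal (by positivity)]

theorem Regular.tendsto_firstAfter {ξ : ℕ → ℝ × Angle} (h : Regular ξ) :
    Tendsto (firstAfter ξ) atTop atTop := by
  refine tendsto_atTop.2 fun b => ?_
  filter_upwards [eventually_ge_atTop (arrival ξ b)] with s hs
  exact (h.lt_firstAfter_iff.2 hs).le

/-- With `N` targets up to time `s`, the partial sums satisfy `S N ≤ s < S (N + 1)`, which squeezes
`N / s` between two sequences that tend to `lam`. -/
theorem Regular.tendsto_firstAfter_div {lam : ℝ} (hlam : 0 < lam) {ξ : ℕ → ℝ × Angle}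
    (h : Regular ξ) (hlim : Tendsto (fun n : ℕ => (∑ i ∈ Finset.range n, (ξ i).1) / (n : ℝ))
      atTop (𝓝 (1 / lam))) :
    Tendsto (fun s => (firstAfter ξ s : ℝ) / s) atTop (𝓝 lam) := by
  set S : ℕ → ℝ := fun n => ∑ i ∈ Finset.range n, (ξ i).1 with hS
  have hg : Tendsto (fun n : ℕ => (n : ℝ) / S n) atTop (𝓝 lam) := by
    have := hlim.inv₀ (by positivity)
    simpa [inv_div] using this
  have hS1 : Tendsto (fun n => S (n + 1)) atTop atTop := h.2
  have hh : Tendsto (fun n : ℕ => (n : ℝ) / S (n + 1)) atTop (𝓝 lam) := by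
    have h1 := ((tendsto_add_atTop_iff_nat 1).2 hg).sub (hS1.inv_tendsto_atTop)
    rw [sub_zero] at h1
    refine h1.congr fun n => ?_
    push_cast
    simp only [Pi.inv_apply]
    rw [add_div]
    ring
  have hN := h.tendsto_firstAfter
  refine tendsto_of_tendsto_of_tendsto_of_le_of_le' (hh.comp hN) (hg.comp hN) ?_ ?_
  · filter_upwards [eventually_gt_atTop 0] with s hs
    exact div_le_div_of_nonneg_left (Nat.cast_nonneg _) hs (h.lt_arrival_firstAfter s).le
  · filter_upwards [eventually_gt_atTop 0, hN.eventually_gt_atTop 0] with s hs hpos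
    have h1 : 0 < S (firstAfter ξ s) :=
      Finset.sum_pos (fun i _ => h.1 i) (Finset.nonempty_range_iff.2 hpos.ne')
    exact div_le_div_of_nonneg_left (Nat.cast_nonneg _) h1 (sum_le_of_firstAfter hs.le ξ)

/-- The relative number of targets that have reached the perimeter converges in mean. -/
theorem tendsto_integral_abs_one_sub {lam : ℝ} [IsProbabilityMeasure (markLaw lam)]
    (hlam : 0 < lam) {T : ℝ} (hT : 0 ≤ T) :
    Tendsto (fun t => ∫ ξ, |1 - (firstAfter ξ (t - T) : ℝ) / (lam * t)| ∂seqLaw (markLaw lam))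
      atTop (𝓝 0) := by
  have hint : ∀ t, Integrable (fun ξ => 1 - (firstAfter ξ (t - T) : ℝ) / (lam * t))
      (seqLaw (markLaw lam)) := fun t =>
    (integrable_const _).sub ((integrable_firstAfter hlam _).div_const _)
  -- Scheffé's argument: the positive part is bounded by `1`, so dominated convergence applies, and
  -- `|x| = 2 x⁺ - x`, where the mean of `x` is exactly `T / t`.
  have h1 : Tendsto (fun t => ∫ ξ, max (1 - (firstAfter ξ (t - T) : ℝ) / (lam * t)) 0
      ∂seqLaw (markLaw lam)) atTop (𝓝 0) := by
    rw [show 𝓝 (0 : ℝ) = 𝓝 (∫ _ξ, (0 : ℝ) ∂seqLaw (markLaw lam)) by simp]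
    refine tendsto_integral_filter_of_dominated_convergence (fun _ => 1) ?_ ?_
      (integrable_const _) ?_
    · exact Eventually.of_forall fun t => (hint t).pos_part.1
    · filter_upwards [eventually_gt_atTop 0] with t ht
      refine ae_of_all _ fun ξ => ?_
      have : 0 ≤ (firstAfter ξ (t - T) : ℝ) / (lam * t) := by positivity
      rw [Real.norm_of_nonneg (le_max_right _ _)]
      exact max_le (by linarith) zero_le_one
    · filter_upwards [ae_regular hlam, ae_tendsto_arrival_div hlam] with ξ hξ hlim
      have h2 := (hξ.tendsto_firstAfter_div hlam hlim).comp
        (tendsto_atTop_add_const_right atTop (-T) tendsto_id)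
      have h3 : Tendsto (fun t : ℝ => 1 - T * t⁻¹) atTop (𝓝 (1 - T * 0)) :=
        (tendsto_inv_atTop_zero.const_mul T).const_sub 1
      have h4 := ((h2.mul h3).div_const lam).const_sub 1
      have h5 := h4.max (tendsto_const_nhds (x := (0 : ℝ)))
      rw [mul_zero, sub_zero, mul_one, div_self hlam.ne', sub_self, max_self] at h5
      refine h5.congr' ?_
      filter_upwards [eventually_gt_atTop T] with t ht
      have ht0 : t ≠ 0 := by linarith
      have ht1 : t - T ≠ 0 := by linarith
      simp only [Function.comp_apply, id, ← sub_eq_add_neg]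
      congr 2
      field_simp
  have h2 : Tendsto (fun t : ℝ => T * t⁻¹) atTop (𝓝 (T * 0)) :=
    tendsto_inv_atTop_zero.const_mul T
  have h3 := (h1.const_mul 2).sub h2
  rw [mul_zero, mul_zero, sub_zero] at h3
  refine h3.congr' ?_
  filter_upwards [eventually_gt_atTop T] with t ht
  have ht0 : 0 < t := by linarith
  have h4 : ∫ ξ, (1 - (firstAfter ξ (t - T) : ℝ) / (lam * t)) ∂seqLaw (markLaw lam) =
      T * t⁻¹ := by
    rw [integral_sub (integrable_const _) ((integrable_firstAfter hlam _).div_const _),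
      integral_div, integral_firstAfter hlam (by linarith)]
    simp
    field_simp
    ring
  rw [← h4, ← integral_const_mul, ← integral_sub ((hint t).pos_part.const_mul 2) (hint t)]
  refine integral_congr_ae (ae_of_all _ fun ξ => ?_)
  simp only
  rcases le_total 0 (1 - (firstAfter ξ (t - T) : ℝ) / (lam * t)) with h | h
  · rw [max_eq_left h, abs_of_nonneg h]; ring
  · rw [max_eq_right h, abs_of_nonpos h]; ring

/-! ### Longest chains of targets -/

/-- A vehicle that captures target `j` at the perimeter can capture target `k` afterwards. -/
def Follows (ρ : ℝ) (ξ : ℕ → ℝ × Angle) (j k : ℕ) : Prop :=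
  arrival ξ j < arrival ξ k ∧ ρ * ‖(ξ k).2 - (ξ j).2‖ ≤ arrival ξ k - arrival ξ j

/-- A chain of targets generated in the time interval `(y, z]`. -/
def IsChainIn (ρ : ℝ) (ξ : ℕ → ℝ × Angle) (y z : ℝ) (l : List ℕ) : Prop :=
  l.IsChain (Follows ρ ξ) ∧ ∀ i ∈ l, y < arrival ξ i ∧ arrival ξ i ≤ z

/-- The length of a longest chain of targets generated in the time interval `(y, z]`. -/
noncomputable def longestChain (ρ : ℝ) (ξ : ℕ → ℝ × Angle) (y z : ℝ) : ℝ≥0∞ :=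
  ⨆ l : List ℕ, ⨆ _ : IsChainIn ρ ξ y z l, (l.length : ℝ≥0∞)

/-- The mean length of a longest chain of targets generated up to time `x`. -/
noncomputable def meanLongest (ν : Measure (ℝ × Angle)) [IsProbabilityMeasure ν] (ρ x : ℝ) :
    ℝ≥0∞ :=
  ∫⁻ ξ, longestChain ρ ξ 0 x ∂seqLaw ν

theorem Follows.trans {ρ : ℝ} (hρ : 0 ≤ ρ) {ξ : ℕ → ℝ × Angle} {i j k : ℕ} (h : Follows ρ ξ i j)
    (h' : Follows ρ ξ j k) : Follows ρ ξ i k := by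
  refine ⟨h.1.trans h'.1, ?_⟩
  have h1 : ‖(ξ k).2 - (ξ i).2‖ ≤ ‖(ξ k).2 - (ξ j).2‖ + ‖(ξ j).2 - (ξ i).2‖ :=
    norm_sub_le_norm_sub_add_norm_sub _ _ _
  have h2 := mul_le_mul_of_nonneg_left h1 hρ
  linarith [h.2, h'.2]

/-- Transitivity makes every sublist of a chain a chain, which allows chains to be cut by filtering.
-/
theorem isChain_follows_iff {ρ : ℝ} (hρ : 0 ≤ ρ) {ξ : ℕ → ℝ × Angle} {l : List ℕ} :
    l.IsChain (Follows ρ ξ) ↔ l.Pairwise (Follows ρ ξ) := by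
  have : IsTrans ℕ (Follows ρ ξ) := ⟨fun _ _ _ => Follows.trans hρ⟩
  exact List.isChain_iff_pairwise

theorem measurableSet_follows (ρ : ℝ) (j k : ℕ) : MeasurableSet {ξ | Follows ρ ξ j k} := by
  refine (measurableSet_lt (measurable_arrival j) (measurable_arrival k)).inter
    (measurableSet_le ?_ ((measurable_arrival k).sub (measurable_arrival j)))
  fun_prop

theorem measurableSet_isChainIn (ρ y z : ℝ) (l : List ℕ) :
    MeasurableSet {ξ | IsChainIn ρ ξ y z l} := by
  have : {ξ | IsChainIn ρ ξ y z l} =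
      (⋂ i, ⋂ h : i + 1 < l.length, {ξ | Follows ρ ξ l[i] l[i + 1]}) ∩
        ⋂ i, ⋂ _ : i ∈ l, {ξ | y < arrival ξ i ∧ arrival ξ i ≤ z} := by
    ext ξ
    simp [IsChainIn, List.isChain_iff_getElem]
  rw [this]
  refine MeasurableSet.inter ?_ ?_
  · exact MeasurableSet.iInter fun i => MeasurableSet.iInter fun _ => measurableSet_follows _ _ _
  · exact MeasurableSet.iInter fun i => MeasurableSet.iInter fun _ =>
      (measurableSet_lt measurable_const (measurable_arrival i)).inter
        (measurableSet_le (measurable_arrival i) measurable_const)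

theorem measurable_longestChain (ρ y z : ℝ) : Measurable fun ξ => longestChain ρ ξ y z := by
  refine Measurable.iSup fun l => ?_
  have : (fun ξ => ⨆ _ : IsChainIn ρ ξ y z l, (l.length : ℝ≥0∞)) =
      {ξ | IsChainIn ρ ξ y z l}.indicator fun _ => (l.length : ℝ≥0∞) := by
    ext ξ
    by_cases h : IsChainIn ρ ξ y z l <;> simp [h]
  rw [this]
  exact measurable_const.indicator (measurableSet_isChainIn ρ y z l)

theorem length_le_longestChain {ρ : ℝ} {ξ : ℕ → ℝ × Angle} {y z : ℝ} {l : List ℕ}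
    (h : IsChainIn ρ ξ y z l) : (l.length : ℝ≥0∞) ≤ longestChain ρ ξ y z :=
  le_iSup₂_of_le l h le_rfl

theorem longestChain_le {ρ : ℝ} {ξ : ℕ → ℝ × Angle} {y z : ℝ} {C : ℝ≥0∞}
    (h : ∀ l, IsChainIn ρ ξ y z l → (l.length : ℝ≥0∞) ≤ C) : longestChain ρ ξ y z ≤ C :=
  iSup₂_le h

theorem longestChain_mono {ρ : ℝ} {ξ : ℕ → ℝ × Angle} {y z z' : ℝ} (hz : z ≤ z') :
    longestChain ρ ξ y z ≤ longestChain ρ ξ y z' :=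
  longestChain_le fun _ hl =>
    length_le_longestChain ⟨hl.1, fun i hi => ⟨(hl.2 i hi).1, (hl.2 i hi).2.trans hz⟩⟩

/-- A chain is cut at generation time `y`; both parts are sublists, hence chains. -/
theorem longestChain_le_add {ρ : ℝ} (hρ : 0 ≤ ρ) (ξ : ℕ → ℝ × Angle) (x y z : ℝ) :
    longestChain ρ ξ x z ≤ longestChain ρ ξ x y + longestChain ρ ξ y z := by
  classical
  refine longestChain_le fun l hl => ?_
  have hp := (isChain_follows_iff hρ).1 hl.1
  have h1 : IsChainIn ρ ξ x y (l.filter fun i => arrival ξ i ≤ y) := by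
    refine ⟨(isChain_follows_iff hρ).2 (hp.filter _), fun i hi => ?_⟩
    have := List.mem_filter.1 hi
    exact ⟨(hl.2 i this.1).1, by simpa using this.2⟩
  have h2 : IsChainIn ρ ξ y z (l.filter fun i => ¬ arrival ξ i ≤ y) := by
    refine ⟨(isChain_follows_iff hρ).2 (hp.filter _), fun i hi => ?_⟩
    have := List.mem_filter.1 hi
    exact ⟨by simpa using this.2, (hl.2 i this.1).2⟩
  have h3 : l.length = (l.filter fun i => arrival ξ i ≤ y).length +
      (l.filter fun i => ¬ arrival ξ i ≤ y).length := by
    simpa only [decide_not] using l.length_eq_length_filter_add fun i => decide (arrival ξ i ≤ y)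
  rw [h3, Nat.cast_add]
  exact add_le_add (length_le_longestChain h1) (length_le_longestChain h2)

theorem longestChain_le_firstAfter {ρ : ℝ} (hρ : 0 ≤ ρ) {ξ : ℕ → ℝ × Angle} (hξ : Regular ξ)
    (y z : ℝ) : longestChain ρ ξ y z ≤ firstAfter ξ z := by
  refine longestChain_le fun l hl => ?_
  have hnd : l.Nodup := ((isChain_follows_iff hρ).1 hl.1).imp fun h hij => by
    subst hij; exact lt_irrefl _ h.1
  rw [← List.toFinset_card_of_nodup hnd]
  refine Nat.cast_le.2 ?_
  calc l.toFinset.card ≤ (Finset.range (firstAfter ξ z)).card := by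
        refine Finset.card_le_card fun i hi => ?_
        exact Finset.mem_range.2 (hξ.lt_firstAfter_iff.2 (hl.2 i (List.mem_toFinset.1 hi)).2)
    _ = firstAfter ξ z := Finset.card_range _

theorem follows_splice_add (ρ t : ℝ) (ξ η : ℕ → ℝ × Angle) (i j : ℕ) :
    Follows ρ (splice t ξ η) (firstAfter ξ t + i) (firstAfter ξ t + j) ↔ Follows ρ η i j := by
  simp only [Follows, arrival_splice_add, splice_add_snd, add_lt_add_iff_left,
    add_sub_add_left_eq_sub]

theorem isChain_map_splice (ρ t : ℝ) (ξ η : ℕ → ℝ × Angle) (l : List ℕ) :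
    (l.map (firstAfter ξ t + ·)).IsChain (Follows ρ (splice t ξ η)) ↔
      l.IsChain (Follows ρ η) := by
  rw [List.isChain_map]
  simp only [follows_splice_add]

/-- Chains depend only on angles and on differences of generation times, and after time `t` the
spliced sequence is `η` shifted by `t`. -/
theorem longestChain_splice (ρ t z : ℝ) (ξ η : ℕ → ℝ × Angle) :
    longestChain ρ (splice t ξ η) t z = longestChain ρ η 0 (z - t) := by
  have key : ∀ l : List ℕ, IsChainIn ρ (splice t ξ η) t z (l.map (firstAfter ξ t + ·)) ↔
      IsChainIn ρ η 0 (z - t) l := by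
    intro l
    unfold IsChainIn
    rw [isChain_map_splice]
    simp only [List.mem_map, forall_exists_index, and_imp, forall_apply_eq_imp_iff₂,
      arrival_splice_add, lt_add_iff_pos_right, le_sub_iff_add_le']
  apply le_antisymm
  · refine longestChain_le fun l hl => ?_
    have hk : ∀ i ∈ l, firstAfter ξ t ≤ i := by
      intro i hi
      by_contra! hlt
      have := (hl.2 i hi).1
      rw [arrival_splice_of_lt hlt] at this
      exact absurd (arrival_le_of_lt_firstAfter hlt) (not_le.2 this)
    have hm : (l.map (· - firstAfter ξ t)).map (firstAfter ξ t + ·) = l := by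
      rw [List.map_map]
      conv_rhs => rw [← List.map_id l]
      refine List.map_congr_left fun i hi => ?_
      have := hk i hi
      simp only [Function.comp_apply, id]
      omega
    rw [← hm] at hl
    have := length_le_longestChain ((key _).1 hl)
    simpa using this
  · refine longestChain_le fun l hl => ?_
    have := length_le_longestChain ((key l).2 hl)
    simpa using this

/-! ### Stationarity and subadditivity of the mean longest chain -/

section Mean

variable {ν : Measure (ℝ × Angle)} [IsProbabilityMeasure ν]

theorem lintegral_longestChain (hν : Memoryless ν) (hreg : ∀ᵐ ξ ∂seqLaw ν, Regular ξ) (ρ : ℝ)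
    {y : ℝ} (hy : 0 ≤ y) (z : ℝ) :
    ∫⁻ ξ, longestChain ρ ξ y z ∂seqLaw ν = meanLongest ν ρ (z - y) := by
  rw [lintegral_splice_const hν hreg hy (measurable_longestChain ρ y z)]
  simp only [longestChain_splice]
  simp [meanLongest]

theorem meanLongest_mono (ρ : ℝ) : Monotone (meanLongest ν ρ) := fun _ _ h =>
  lintegral_mono fun _ => longestChain_mono h

theorem meanLongest_add_le (hν : Memoryless ν) (hreg : ∀ᵐ ξ ∂seqLaw ν, Regular ξ) {ρ : ℝ}
    (hρ : 0 ≤ ρ) {x : ℝ} (hx : 0 ≤ x) (y : ℝ) :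
    meanLongest ν ρ (x + y) ≤ meanLongest ν ρ x + meanLongest ν ρ y := by
  calc meanLongest ν ρ (x + y)
      ≤ ∫⁻ ξ, (longestChain ρ ξ 0 x + longestChain ρ ξ x (x + y)) ∂seqLaw ν :=
        lintegral_mono fun ξ => longestChain_le_add hρ ξ _ _ _
    _ = meanLongest ν ρ x + meanLongest ν ρ y := by
        rw [lintegral_add_left (measurable_longestChain ρ 0 x),
          lintegral_longestChain hν hreg ρ hx, add_sub_cancel_left]
        rfl

theorem meanLongest_zero (hreg : ∀ᵐ ξ ∂seqLaw ν, Regular ξ) (ρ : ℝ) : meanLongest ν ρ 0 = 0 := by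
  rw [meanLongest, lintegral_congr_ae (g := fun _ => 0), lintegral_zero]
  filter_upwards [hreg] with ξ hξ
  refine le_antisymm (longestChain_le fun l hl => ?_) zero_le
  rcases l with _ | ⟨i, l⟩
  · simp
  · have := hl.2 i (by simp)
    linarith

theorem meanLongest_nsmul_le (hν : Memoryless ν) (hreg : ∀ᵐ ξ ∂seqLaw ν, Regular ξ) {ρ : ℝ}
    (hρ : 0 ≤ ρ) {x : ℝ} (hx : 0 ≤ x) (n : ℕ) :
    meanLongest ν ρ (n * x) ≤ n * meanLongest ν ρ x := by
  induction n with
  | zero => simp [meanLongest_zero hreg]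
  | succ n ih =>
    have := meanLongest_add_le hν hreg hρ (mul_nonneg n.cast_nonneg hx) x
    push_cast
    rw [add_mul, one_mul, add_mul, one_mul]
    exact this.trans (by gcongr)

/-- A window of length `u` is covered by `n = ⌈u / x⌉` windows of length `x`, and `n * x ≤ u + x ≤ u
+ T`. The error `T` is uniform in `x`, so that a single constant serves all iterations. -/
theorem meanLongest_mul_le (hν : Memoryless ν) (hreg : ∀ᵐ ξ ∂seqLaw ν, Regular ξ) {ρ : ℝ}
    (hρ : 0 ≤ ρ) {x T u : ℝ} (hx : 0 ≤ x) (hxT : x ≤ T) (hu : 0 ≤ u) :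
    meanLongest ν ρ u * ENNReal.ofReal x ≤ ENNReal.ofReal (u + T) * meanLongest ν ρ x := by
  rcases hx.eq_or_lt with rfl | hx
  · simp
  set n := ⌈u / x⌉₊
  have h1 : u ≤ n * x := (div_le_iff₀ hx).1 (Nat.le_ceil _)
  have h2 : n * x ≤ u + T := by
    have : (n : ℝ) < u / x + 1 := Nat.ceil_lt_add_one (by positivity)
    have h3 := mul_lt_mul_of_pos_right this hx
    rw [add_mul, div_mul_cancel₀ _ hx.ne'] at h3
    linarith
  calc meanLongest ν ρ u * ENNReal.ofReal x
      ≤ n * meanLongest ν ρ x * ENNReal.ofReal x := by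
        gcongr
        exact (meanLongest_mono ρ h1).trans (meanLongest_nsmul_le hν hreg hρ hx.le n)
    _ = ENNReal.ofReal (n * x) * meanLongest ν ρ x := by
        rw [ENNReal.ofReal_mul n.cast_nonneg, ENNReal.ofReal_natCast]
        ring
    _ ≤ ENNReal.ofReal (u + T) * meanLongest ν ρ x := by gcongr

end Mean

theorem meanLongest_le {lam : ℝ} [IsProbabilityMeasure (markLaw lam)] (hlam : 0 < lam) {ρ x : ℝ}
    (hρ : 0 ≤ ρ) (hx : 0 ≤ x) : meanLongest (markLaw lam) ρ x ≤ ENNReal.ofReal (lam * x) := by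
  rw [← lintegral_firstAfter hlam hx]
  refine lintegral_mono_ae ?_
  filter_upwards [ae_regular hlam] with ξ hξ
  exact longestChain_le_firstAfter hρ hξ 0 x

/-! ### The iterations of the Look-Ahead policy -/

/-- A path, in the reachability graph at time `t`, of targets that are outstanding at time `t`;
here `T` is the time between generation and arrival at the perimeter. -/
def IsTour (ρ T : ℝ) (ξ : ℕ → ℝ × Angle) (t : ℝ) (φ : Angle) (l : List ℕ) : Prop :=
  (∀ i ∈ l.head?, ρ * ‖(ξ i).2 - φ‖ ≤ arrival ξ i + T - t) ∧ IsChainIn ρ ξ (t - T) t l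

section Plan

variable {v ρ : ℝ} (D : ℝ) (rule : LongestPathRule v ρ)

/-- The path selected at time `t` at the angle `φ` if the outstanding targets are those
with indices in `[j, k)`. -/
noncomputable def planOf (j k : ℕ) (ξ : ℕ → ℝ × Angle) (t : ℝ) (φ : Angle) : List ℕ :=
  (rule.path (k - j) φ fun i => location v D (arrival ξ (j + i)) (ξ (j + i)).2 t).map
    fun i : Fin (k - j) => j + (i : ℕ)

/-- The path selected by the Look-Ahead policy at time `t` at the angle `φ`. -/
noncomputable def plan (ξ : ℕ → ℝ × Angle) (t : ℝ) (φ : Angle) : List ℕ :=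
  planOf D rule (firstAfter ξ (t - (D - ρ) / v)) (firstAfter ξ t) ξ t φ

/-- Time and angle at the end of an iteration. -/
noncomputable def nextState (ξ : ℕ → ℝ × Angle) (s : ℝ × Angle) : ℝ × Angle :=
  (plan D rule ξ s.1 s.2).getLast?.elim (arrival ξ (firstAfter ξ s.1), s.2)
    fun i => (arrival ξ i + (D - ρ) / v, (ξ i).2)

/-- Time and angle at the beginning of each iteration. -/
noncomputable def state (φ₀ : Angle) (ξ : ℕ → ℝ × Angle) : ℕ → ℝ × Angle
  | 0 => (0, φ₀)
  | m + 1 => nextState D rule ξ (state φ₀ ξ m)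

/-- The path selected in iteration `m`. -/
noncomputable def planAt (φ₀ : Angle) (ξ : ℕ → ℝ × Angle) (m : ℕ) : List ℕ :=
  plan D rule ξ (state D rule φ₀ ξ m).1 (state D rule φ₀ ξ m).2

variable {D rule}

/-! ### Reachability in terms of generation times -/

theorem mul_norm_mul_le_iff (hv : 0 < v) (x y : ℝ) : v * x * ρ ≤ v * y ↔ ρ * x ≤ y := by
  rw [mul_assoc, mul_le_mul_iff_right₀ hv, mul_comm]

/-- Dividing radial distances by `v` turns them into times: the travel time along the perimeter must
not exceed the time left until the target is due. -/
theorem reachable_location_iff (hv : 0 < v) (φ θ : Angle) (a t : ℝ) :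
    Reachable v ρ φ (location v D a θ t) ↔ ρ * ‖θ - φ‖ ≤ a + (D - ρ) / v - t := by
  rw [← mul_norm_mul_le_iff hv]
  simp only [Reachable, location]
  have : v * (a + (D - ρ) / v - t) = D - v * (t - a) - ρ := by field_simp; ring
  rw [this]

/-- All targets move with the same speed, so radial differences, and with them the edges, do not
change with `t`. -/
theorem edge_location_iff (hv : 0 < v) (ξ : ℕ → ℝ × Angle) (t : ℝ) (j k : ℕ) :
    Edge v ρ (location v D (arrival ξ j) (ξ j).2 t) (location v D (arrival ξ k) (ξ k).2 t) ↔
      Follows ρ ξ j k := by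
  unfold Follows
  rw [← mul_norm_mul_le_iff hv, ← mul_lt_mul_iff_right₀ hv]
  simp only [Edge, Reachable, location]
  constructor <;> rintro ⟨h1, h2⟩ <;> constructor <;> linarith

/-- The targets generated in `(t - T, t]` have consecutive indices. For lists of such indices the
window condition of `IsTour` holds automatically. -/
theorem isPath_iff (hv : 0 < v) {ξ : ℕ → ℝ × Angle} (hξ : Regular ξ) (t : ℝ) (φ : Angle)
    (l : List (Fin (firstAfter ξ t - firstAfter ξ (t - (D - ρ) / v)))) :
    IsPath v ρ φ (fun i : Fin (firstAfter ξ t - firstAfter ξ (t - (D - ρ) / v)) =>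
      location v D (arrival ξ (firstAfter ξ (t - (D - ρ) / v) + i))
        (ξ (firstAfter ξ (t - (D - ρ) / v) + i)).2 t) l ↔
    IsTour ρ ((D - ρ) / v) ξ t φ
      (l.map fun i : Fin _ => firstAfter ξ (t - (D - ρ) / v) + (i : ℕ)) := by
  have hw : ∀ i : Fin (firstAfter ξ t - firstAfter ξ (t - (D - ρ) / v)),
      t - (D - ρ) / v < arrival ξ (firstAfter ξ (t - (D - ρ) / v) + i) ∧
        arrival ξ (firstAfter ξ (t - (D - ρ) / v) + i) ≤ t := by
    intro i
    have hi := i.2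
    refine ⟨?_, hξ.lt_firstAfter_iff.1 (by omega)⟩
    rw [← not_le, ← hξ.lt_firstAfter_iff]
    omega
  simp only [IsPath, IsTour, IsChainIn, reachable_location_iff hv, edge_location_iff hv,
    List.isChain_map, List.head?_map, Option.mem_map, forall_exists_index, and_imp,
    forall_apply_eq_imp_iff₂, List.mem_map]
  exact and_congr_right fun _ => ⟨fun h => ⟨h, fun i _ => hw i⟩, fun h => h.1⟩

theorem isTour_plan (hv : 0 < v) {ξ : ℕ → ℝ × Angle} (hξ : Regular ξ) (t : ℝ) (φ : Angle) :
    IsTour ρ ((D - ρ) / v) ξ t φ (plan D rule ξ t φ) :=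
  (isPath_iff hv hξ t φ _).1 (rule.longest _ _ _).1

theorem IsTour.length_le_plan (hv : 0 < v) {ξ : ℕ → ℝ × Angle} (hξ : Regular ξ) {t : ℝ}
    {φ : Angle} {l : List ℕ} (hl : IsTour ρ ((D - ρ) / v) ξ t φ l) :
    l.length ≤ (plan D rule ξ t φ).length := by
  set j := firstAfter ξ (t - (D - ρ) / v) with hj
  set k := firstAfter ξ t with hk
  have hr : ∀ i ∈ l, ∃ i' : Fin (k - j), j + (i' : ℕ) = i := by
    intro i hi
    have h := hl.2.2 i hi
    have h1 : i < k := hξ.lt_firstAfter_iff.2 h.2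
    have h2 : j ≤ i := by
      rw [← not_lt, hj, hξ.lt_firstAfter_iff]; exact not_le.2 h.1
    exact ⟨⟨i - j, by omega⟩, by simp only; omega⟩
  have hex : ∃ l' : List (Fin (k - j)), l'.map (fun i : Fin (k - j) => j + (i : ℕ)) = l :=
    (Set.range_list_map fun i : Fin (k - j) => j + (i : ℕ)).ge hr
  obtain ⟨l', rfl⟩ := hex
  have := (rule.longest _ _ _).2 l' ((isPath_iff (D := D) hv hξ t φ l').2 hl)
  simpa [plan, planOf] using this

/-! ### Causality of the policy -/

theorem planOf_congr {j k : ℕ} {ξ ζ : ℕ → ℝ × Angle} (h : ∀ i < k, ζ i = ξ i) (t : ℝ)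
    (φ : Angle) : planOf D rule j k ζ t φ = planOf D rule j k ξ t φ := by
  have : (fun i : Fin (k - j) => location v D (arrival ζ (j + i)) (ζ (j + i)).2 t) =
      fun i : Fin (k - j) => location v D (arrival ξ (j + i)) (ξ (j + i)).2 t := by
    ext1 i
    have hi := i.2
    rw [arrival_congr fun n hn => h n (by omega), h _ (by omega)]
  rw [planOf, planOf, this]

theorem firstAfter_congr {ξ ζ : ℕ → ℝ × Angle} (hξ : Regular ξ) {s t : ℝ}
    (h : ∀ i < firstAfter ξ s, ζ i = ξ i) (hs : s < arrival ζ (firstAfter ξ s)) (hts : t ≤ s) :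
    firstAfter ζ t = firstAfter ξ t := by
  have hle := hξ.firstAfter_mono hts
  refine firstAfter_eq ?_ fun i hi => ?_
  · rcases hle.lt_or_eq with hlt | heq
    · rw [arrival_congr fun n hn => h n (by omega)]
      exact hξ.lt_arrival_firstAfter t
    · rw [heq]; exact hts.trans_lt hs
  · rw [arrival_congr fun n hn => h n (by omega)]
    exact arrival_le_of_lt_firstAfter hi

theorem plan_congr (hT : 0 ≤ (D - ρ) / v) {ξ ζ : ℕ → ℝ × Angle} (hξ : Regular ξ) {s t : ℝ}
    (h : ∀ i < firstAfter ξ s, ζ i = ξ i) (hs : s < arrival ζ (firstAfter ξ s)) (hts : t ≤ s)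
    (φ : Angle) : plan D rule ζ t φ = plan D rule ξ t φ := by
  rw [plan, plan, firstAfter_congr hξ h hs hts, firstAfter_congr hξ h hs (by linarith)]
  exact planOf_congr (fun i hi => h i (hi.trans_le (hξ.firstAfter_mono hts))) _ _

theorem nextState_of_nil {ξ : ℕ → ℝ × Angle} {s : ℝ × Angle} (h : plan D rule ξ s.1 s.2 = []) :
    nextState D rule ξ s = (arrival ξ (firstAfter ξ s.1), s.2) := by
  simp [nextState, h]

theorem nextState_of_getLast {ξ : ℕ → ℝ × Angle} {s : ℝ × Angle} {i : ℕ}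
    (h : (plan D rule ξ s.1 s.2).getLast? = some i) :
    nextState D rule ξ s = (arrival ξ i + (D - ρ) / v, (ξ i).2) := by
  simp [nextState, h]

theorem plan_cases (ξ : ℕ → ℝ × Angle) (s : ℝ × Angle) :
    plan D rule ξ s.1 s.2 = [] ∨
      ∃ i ∈ plan D rule ξ s.1 s.2, (plan D rule ξ s.1 s.2).getLast? = some i := by
  rcases h : (plan D rule ξ s.1 s.2).getLast? with _ | i
  · exact .inl (List.getLast?_eq_none_iff.1 h)
  · exact .inr ⟨i, List.mem_of_getLast? h, rfl⟩

/-- A waiting phase ends at a later generation time; a selected target is outstanding, hence due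
strictly later. -/
theorem lt_nextState (hv : 0 < v) {ξ : ℕ → ℝ × Angle} (hξ : Regular ξ) (s : ℝ × Angle) :
    s.1 < (nextState D rule ξ s).1 := by
  rcases plan_cases (D := D) (rule := rule) ξ s with h | ⟨i, hi, h⟩
  · rw [nextState_of_nil h]
    exact hξ.lt_arrival_firstAfter _
  · rw [nextState_of_getLast h]
    have := ((isTour_plan hv hξ s.1 s.2).2.2 i hi).1
    simp only
    linarith

variable {φ₀ : Angle}

theorem strictMono_state (hv : 0 < v) {ξ : ℕ → ℝ × Angle} (hξ : Regular ξ) :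
    StrictMono fun m => (state D rule φ₀ ξ m).1 :=
  strictMono_nat_of_lt_succ fun _ => lt_nextState hv hξ _

theorem state_nonneg (hv : 0 < v) {ξ : ℕ → ℝ × Angle} (hξ : Regular ξ) (m : ℕ) :
    0 ≤ (state D rule φ₀ ξ m).1 :=
  (strictMono_state (φ₀ := φ₀) hv hξ).monotone m.zero_le

/-- Iterations before `m` end no later than state `m`. Each ends either when an already generated
target is due or at a generation time not after state `m`, so the targets generated up to that time
determine it. -/
theorem state_congr (hv : 0 < v) (hT : 0 ≤ (D - ρ) / v) {ξ ζ : ℕ → ℝ × Angle} (hξ : Regular ξ)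
    {m : ℕ} (h : ∀ i < firstAfter ξ (state D rule φ₀ ξ m).1, ζ i = ξ i)
    (hs : (state D rule φ₀ ξ m).1 < arrival ζ (firstAfter ξ (state D rule φ₀ ξ m).1)) :
    ∀ n ≤ m, state D rule φ₀ ζ n = state D rule φ₀ ξ n := by
  have hmono := strictMono_state (D := D) (rule := rule) (φ₀ := φ₀) hv hξ
  intro n
  induction n with
  | zero => intro _; rfl
  | succ n ih =>
    intro hn
    have hle : (state D rule φ₀ ξ n).1 ≤ (state D rule φ₀ ξ m).1 :=
      hmono.monotone (by omega)
    have hle' : (nextState D rule ξ (state D rule φ₀ ξ n)).1 ≤ (state D rule φ₀ ξ m).1 :=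
      hmono.monotone (a := n + 1) hn
    change nextState D rule ζ (state D rule φ₀ ζ n) = nextState D rule ξ (state D rule φ₀ ξ n)
    rw [ih (by omega)]
    have hp := plan_congr (rule := rule) hT hξ h hs hle (state D rule φ₀ ξ n).2
    rcases plan_cases (D := D) (rule := rule) ξ (state D rule φ₀ ξ n) with he | ⟨i, hi, he⟩
    · rw [nextState_of_nil he] at hle' ⊢
      rw [nextState_of_nil (hp.trans he), firstAfter_congr hξ h hs hle,
        arrival_congr fun j hj => h j (hj.trans_lt (hξ.lt_firstAfter_iff.2 hle'))]
    · rw [nextState_of_getLast he, nextState_of_getLast (hp ▸ he)]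
      have hik : i < firstAfter ξ (state D rule φ₀ ξ m).1 :=
        hξ.lt_firstAfter_iff.2 (((isTour_plan hv hξ _ _).2.2 i hi).2.trans hle)
      rw [arrival_congr fun j hj => h j (hj.trans_lt hik), h i hik]

theorem isStopping_state (hv : 0 < v) (hT : 0 ≤ (D - ρ) / v) (m : ℕ) :
    IsStopping fun ξ => (state D rule φ₀ ξ m).1 := fun _ _ hξ _ h hs =>
  congrArg Prod.fst (state_congr hv hT hξ h hs m le_rfl)

/-! ### Measurability of the policy -/

theorem measurable_of_countable_pieces {α β γ : Type*} [MeasurableSpace α] [MeasurableSpace β]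
    [Countable γ] {c : α → γ} (hc : ∀ y, MeasurableSet {x | c x = y}) {g : γ → α → β}
    (hg : ∀ y, Measurable (g y)) : Measurable fun x => g (c x) x := by
  intro s hs
  have : (fun x => g (c x) x) ⁻¹' s = ⋃ y, {x | c x = y} ∩ g y ⁻¹' s := by
    ext x; simp
  rw [this]
  exact MeasurableSet.iUnion fun y => (hc y).inter (hg y hs)

theorem measurableSet_planOf (j k : ℕ) (L : List ℕ) :
    MeasurableSet {x : (ℕ → ℝ × Angle) × (ℝ × Angle) |
      planOf D rule j k x.1 x.2.1 x.2.2 = L} := by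
  have : {x : (ℕ → ℝ × Angle) × (ℝ × Angle) | planOf D rule j k x.1 x.2.1 x.2.2 = L} =
      ⋃ l : List (Fin (k - j)), ⋃ _ : (l.map fun i : Fin (k - j) => j + (i : ℕ)) = L,
        {x | rule.path (k - j) x.2.2 (fun i =>
          location v D (arrival x.1 (j + i)) (x.1 (j + i)).2 x.2.1) = l} := by
    ext x
    simp [planOf]
  rw [this]
  refine MeasurableSet.iUnion fun l => MeasurableSet.iUnion fun _ => ?_
  have hm : Measurable fun x : (ℕ → ℝ × Angle) × (ℝ × Angle) =>
      (x.2.2, fun i : Fin (k - j) =>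
        location v D (arrival x.1 (j + i)) (x.1 (j + i)).2 x.2.1) := by
    refine Measurable.prodMk (by fun_prop) (measurable_pi_lambda _ fun i => ?_)
    unfold location
    have := (measurable_arrival (j + i)).comp
      (measurable_fst : Measurable (Prod.fst : (ℕ → ℝ × Angle) × (ℝ × Angle) → _))
    simp only [Function.comp_def] at this
    fun_prop
  exact hm (rule.measurableSet (k - j) l)

theorem measurableSet_plan (L : List ℕ) :
    MeasurableSet {x : (ℕ → ℝ × Angle) × (ℝ × Angle) |
      plan D rule x.1 x.2.1 x.2.2 = L} := by
  have hj : Measurable fun x : (ℕ → ℝ × Angle) × (ℝ × Angle) =>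
      firstAfter x.1 (x.2.1 - (D - ρ) / v) :=
    measurable_firstAfter measurable_fst (by fun_prop)
  have hk : Measurable fun x : (ℕ → ℝ × Angle) × (ℝ × Angle) => firstAfter x.1 x.2.1 :=
    measurable_firstAfter measurable_fst (by fun_prop)
  have : {x : (ℕ → ℝ × Angle) × (ℝ × Angle) | plan D rule x.1 x.2.1 x.2.2 = L} =
      ⋃ j, ⋃ k, {x | firstAfter x.1 (x.2.1 - (D - ρ) / v) = j} ∩ {x | firstAfter x.1 x.2.1 = k} ∩
        {x | planOf D rule j k x.1 x.2.1 x.2.2 = L} := by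
    ext x
    simp [plan]
  rw [this]
  exact MeasurableSet.iUnion fun j => MeasurableSet.iUnion fun k =>
    ((hj (measurableSet_singleton j)).inter (hk (measurableSet_singleton k))).inter
      (measurableSet_planOf j k L)

theorem measurable_nextState :
    Measurable fun x : (ℕ → ℝ × Angle) × (ℝ × Angle) => nextState D rule x.1 x.2 := by
  refine measurable_of_countable_pieces (c := fun x : (ℕ → ℝ × Angle) × (ℝ × Angle) =>
    plan D rule x.1 x.2.1 x.2.2) measurableSet_plan
    (g := fun L x => L.getLast?.elim (arrival x.1 (firstAfter x.1 x.2.1), x.2.2)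
      fun i => (arrival x.1 i + (D - ρ) / v, (x.1 i).2)) fun L => ?_
  have ha : ∀ i, Measurable fun x : (ℕ → ℝ × Angle) × (ℝ × Angle) => arrival x.1 i := fun i =>
    (measurable_arrival i).comp measurable_fst
  rcases L.getLast? with _ | i
  · have hk : Measurable fun x : (ℕ → ℝ × Angle) × (ℝ × Angle) => firstAfter x.1 x.2.1 :=
      measurable_firstAfter measurable_fst (by fun_prop)
    have h1 : Measurable fun x : (ℕ → ℝ × Angle) × (ℝ × Angle) =>
        arrival x.1 (firstAfter x.1 x.2.1) :=
      measurable_of_countable_pieces (fun k => hk (measurableSet_singleton k))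
        (g := fun k x => arrival x.1 k) ha
    exact h1.prodMk (by fun_prop)
  · exact Measurable.prodMk ((ha i).add measurable_const) (by fun_prop)

theorem measurable_state (m : ℕ) : Measurable fun ξ => state D rule φ₀ ξ m := by
  induction m with
  | zero => exact measurable_const
  | succ m ih =>
    have h : Measurable fun ξ => (ξ, state D rule φ₀ ξ m) := measurable_id.prodMk ih
    exact (measurable_nextState (D := D) (rule := rule)).comp h

theorem measurable_length_planAt (m : ℕ) :
    Measurable fun ξ => ((planAt D rule φ₀ ξ m).length : ℝ≥0∞) := by
  have h : Measurable fun ξ => (ξ, state D rule φ₀ ξ m) := measurable_id.prodMk (measurable_state m)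
  exact measurable_of_countable_pieces (c := fun ξ => planAt D rule φ₀ ξ m)
    (fun L => h (measurableSet_plan L)) (g := fun L _ => (L.length : ℝ≥0∞))
    fun _ => measurable_const

end Plan

theorem Angle.norm_le_pi (x : Angle) : ‖x‖ ≤ Real.pi := by
  have := AddCircle.norm_le_half_period (2 * Real.pi) Real.two_pi_pos.ne' (x := x)
  rwa [abs_of_pos Real.two_pi_pos, mul_div_cancel_left₀ _ two_ne_zero] at this

/-! ### Mean number of captures in the next iteration -/

section Iteration

variable {v ρ D : ℝ} {rule : LongestPathRule v ρ} {φ₀ : Angle}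

theorem state_splice (hv : 0 < v) (hT : 0 ≤ (D - ρ) / v) {ξ η : ℕ → ℝ × Angle}
    (hξ : Regular ξ) (hη : Regular η) (m : ℕ) :
    state D rule φ₀ (splice (state D rule φ₀ ξ m).1 ξ η) m = state D rule φ₀ ξ m := by
  refine state_congr hv hT hξ (fun i hi => splice_of_lt hi η) ?_ m le_rfl
  have := arrival_splice_add (state D rule φ₀ ξ m).1 ξ η 0
  rw [add_zero] at this
  rw [this]
  linarith [hη.arrival_pos 0]

theorem planAt_splice (hv : 0 < v) (hT : 0 ≤ (D - ρ) / v) {ξ η : ℕ → ℝ × Angle}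
    (hξ : Regular ξ) (hη : Regular η) (m : ℕ) :
    planAt D rule φ₀ (splice (state D rule φ₀ ξ m).1 ξ η) m = planAt D rule φ₀ ξ m := by
  rw [planAt, planAt, state_splice hv hT hξ hη]
  refine plan_congr hT hξ (fun i hi => splice_of_lt hi η) ?_ le_rfl _
  have := arrival_splice_add (state D rule φ₀ ξ m).1 ξ η 0
  rw [add_zero] at this
  rw [this]
  linarith [hη.arrival_pos 0]

theorem state_succ_of_nil {ξ : ℕ → ℝ × Angle} {m : ℕ} (h : planAt D rule φ₀ ξ m = []) :
    state D rule φ₀ ξ (m + 1) =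
      (arrival ξ (firstAfter ξ (state D rule φ₀ ξ m).1), (state D rule φ₀ ξ m).2) :=
  nextState_of_nil h

theorem state_succ_of_getLast {ξ : ℕ → ℝ × Angle} {m i : ℕ}
    (h : (planAt D rule φ₀ ξ m).getLast? = some i) :
    state D rule φ₀ ξ (m + 1) = (arrival ξ i + (D - ρ) / v, (ξ i).2) :=
  nextState_of_getLast h

theorem planAt_cases (ξ : ℕ → ℝ × Angle) (m : ℕ) :
    planAt D rule φ₀ ξ m = [] ∨
      ∃ i ∈ planAt D rule φ₀ ξ m, (planAt D rule φ₀ ξ m).getLast? = some i :=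
  plan_cases ξ _

theorem isTour_planAt (hv : 0 < v) {ξ : ℕ → ℝ × Angle} (hξ : Regular ξ) (m : ℕ) :
    IsTour ρ ((D - ρ) / v) ξ (state D rule φ₀ ξ m).1 (state D rule φ₀ ξ m).2
      (planAt D rule φ₀ ξ m) :=
  isTour_plan hv hξ _ _

theorem IsTour.length_le_planAt (hv : 0 < v) {ξ : ℕ → ℝ × Angle} (hξ : Regular ξ) {m : ℕ}
    {l : List ℕ}
    (h : IsTour ρ ((D - ρ) / v) ξ (state D rule φ₀ ξ m).1 (state D rule φ₀ ξ m).2 l) :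
    l.length ≤ (planAt D rule φ₀ ξ m).length :=
  h.length_le_plan hv hξ

/-- After waiting for a target, the vehicle captures a target. -/
theorem one_le_length_planAt_succ (hv : 0 < v) (hρ : 0 < ρ) (hT : ρ * Real.pi ≤ (D - ρ) / v)
    {ξ : ℕ → ℝ × Angle} (hξ : Regular ξ) {m : ℕ} (h : planAt D rule φ₀ ξ m = []) :
    1 ≤ (planAt D rule φ₀ ξ (m + 1)).length := by
  have hT0 : 0 < (D - ρ) / v := lt_of_lt_of_le (mul_pos hρ Real.pi_pos) hT
  refine IsTour.length_le_planAt (l := [firstAfter ξ (state D rule φ₀ ξ m).1]) hv hξ ?_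
  rw [state_succ_of_nil h]
  refine ⟨fun i hi => ?_, List.isChain_singleton _, fun i hi => ?_⟩
  -- The awaited target has only just been generated. It is due after the full time `(D - ρ) / v`,
  -- which suffices to reach any point of the perimeter.
  · obtain rfl : firstAfter ξ (state D rule φ₀ ξ m).1 = i := by simpa using hi
    have := mul_le_mul_of_nonneg_left (Angle.norm_le_pi
      ((ξ (firstAfter ξ (state D rule φ₀ ξ m).1)).2 - (state D rule φ₀ ξ m).2)) hρ.le
    simp only
    linarith
  · obtain rfl : i = firstAfter ξ (state D rule φ₀ ξ m).1 := by simpa using hi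
    simp only
    exact ⟨by linarith, le_rfl⟩

/-- All targets generated during an iteration that reach the perimeter late enough for the vehicle
to reach them from anywhere can be visited in the next iteration. -/
theorem longestChain_le_length_planAt_succ (hv : 0 < v) (hρ : 0 < ρ)
    {ξ η : ℕ → ℝ × Angle} (hξ : Regular ξ) (hη : Regular η) {m : ℕ} {s y : ℝ} (hy : 0 ≤ y)
    (hy' : s + ρ * Real.pi - (D - ρ) / v ≤ y)
    (hs : s ≤ (D - ρ) / v)
    (h : (state D rule φ₀ (splice (state D rule φ₀ ξ m).1 ξ η) (m + 1)).1 =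
      (state D rule φ₀ ξ m).1 + s) :
    longestChain ρ η y s ≤
      (planAt D rule φ₀ (splice (state D rule φ₀ ξ m).1 ξ η) (m + 1)).length := by
  refine longestChain_le fun l hl => Nat.cast_le.2 ?_
  set σ := (state D rule φ₀ ξ m).1 with hσ
  have hζ : Regular (splice σ ξ η) := hξ.splice hη (state_nonneg hv hξ m)
  have hmem : ∀ i ∈ l.map (firstAfter ξ σ + ·),
      σ + y < arrival (splice σ ξ η) i ∧ arrival (splice σ ξ η) i ≤ σ + s := by
    intro i hi
    obtain ⟨j, hj, rfl⟩ := List.mem_map.1 hi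
    rw [arrival_splice_add]
    have := hl.2 j hj
    exact ⟨by linarith, by linarith⟩
  have htour : IsTour ρ ((D - ρ) / v) (splice σ ξ η)
      (state D rule φ₀ (splice σ ξ η) (m + 1)).1 (state D rule φ₀ (splice σ ξ η) (m + 1)).2
      (l.map (firstAfter ξ σ + ·)) := by
    rw [h]
    refine ⟨fun i hi => ?_, (isChain_map_splice ρ σ ξ η l).2 hl.1, fun i hi => ?_⟩
    -- Target `i` is due after `σ + y + (D - ρ) / v`, thus at least `ρ * π` after the end `σ + s` of
    -- the iteration, wherever the vehicle then is.
    · have h1 := (hmem i (List.mem_of_mem_head? hi)).1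
      have h2 := mul_le_mul_of_nonneg_left (Angle.norm_le_pi
        ((splice σ ξ η i).2 - (state D rule φ₀ (splice σ ξ η) (m + 1)).2)) hρ.le
      linarith
    · have := hmem i hi
      exact ⟨by linarith, this.2⟩
  simpa using htour.length_le_planAt hv hζ

variable {lam : ℝ} [IsProbabilityMeasure (markLaw lam)]

/-- The duration of an iteration bounds the expected number of captures in the next one. -/
theorem lintegral_duration_le (hlam : 0 < lam) (hv : 0 < v) (hρ : 0 < ρ)
    (hT : ρ * Real.pi ≤ (D - ρ) / v) {c : ℝ≥0∞} (hc : c * ENNReal.ofReal (1 / lam) ≤ 1)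
    (hc' : ∀ s, 0 ≤ s → s ≤ (D - ρ) / v →
      c * ENNReal.ofReal s ≤ meanLongest (markLaw lam) ρ (min s ((D - ρ) / v - ρ * Real.pi)))
    (t : ℝ) (m : ℕ) :
    ∫⁻ ξ, {ξ | (state D rule φ₀ ξ m).1 ≤ t}.indicator (fun ξ => c * ENNReal.ofReal
      ((state D rule φ₀ ξ (m + 1)).1 - (state D rule φ₀ ξ m).1)) ξ ∂seqLaw (markLaw lam) ≤
    ∫⁻ ξ, {ξ | (state D rule φ₀ ξ m).1 ≤ t}.indicator (fun ξ =>
      ((planAt D rule φ₀ ξ (m + 1)).length : ℝ≥0∞)) ξ ∂seqLaw (markLaw lam) := by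
  have hT0 : 0 < (D - ρ) / v := lt_of_lt_of_le (mul_pos hρ Real.pi_pos) hT
  have hreg := ae_regular hlam
  have hν := memoryless_markLaw hlam
  have hm : ∀ m, Measurable fun ξ => (state D rule φ₀ ξ m).1 := fun m =>
    measurable_fst.comp (measurable_state m)
  have hset : MeasurableSet {ξ | (state D rule φ₀ ξ m).1 ≤ t} :=
    measurableSet_le (hm m) measurable_const
  have hdm : Measurable fun ξ => c * ENNReal.ofReal
      ((state D rule φ₀ ξ (m + 1)).1 - (state D rule φ₀ ξ m).1) :=
    ((hm (m + 1)).sub (hm m)).ennreal_ofReal.const_mul c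
  have hstopping := isStopping_state (D := D) (rule := rule) (φ₀ := φ₀) hv hT0.le m
  -- Both sides are conditioned on the targets generated up to the start `σ` of iteration `m`; later
  -- targets are replaced by a fresh sequence `η`.
  rw [hstopping.lintegral_splice hν hreg (hm m) (fun ξ hξ => state_nonneg hv hξ m)
      (hdm.indicator hset),
    hstopping.lintegral_splice hν hreg (hm m) (fun ξ hξ => state_nonneg hv hξ m)
      ((measurable_length_planAt (m + 1)).indicator hset)]
  refine lintegral_mono_ae ?_
  filter_upwards [hreg] with ξ hξ
  set σ := (state D rule φ₀ ξ m).1 with hσ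
  have hstate : ∀ η, Regular η → state D rule φ₀ (splice σ ξ η) m = state D rule φ₀ ξ m :=
    fun η hη => state_splice hv hT0.le hξ hη m
  by_cases hle : σ ≤ t
  swap
  · rw [lintegral_congr_ae (g := fun _ => 0)]
    · simp
    · filter_upwards [hreg] with η hη
      refine Set.indicator_of_notMem ?_ _
      simpa only [Set.mem_ofPred_eq, hstate η hη] using hle
  have hL : ∫⁻ η, {ξ | (state D rule φ₀ ξ m).1 ≤ t}.indicator (fun ξ => c * ENNReal.ofReal
      ((state D rule φ₀ ξ (m + 1)).1 - (state D rule φ₀ ξ m).1)) (splice σ ξ η)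
        ∂seqLaw (markLaw lam) =
      ∫⁻ η, c * ENNReal.ofReal ((state D rule φ₀ (splice σ ξ η) (m + 1)).1 - σ)
        ∂seqLaw (markLaw lam) := by
    refine lintegral_congr_ae ?_
    filter_upwards [hreg] with η hη
    rw [Set.indicator_of_mem]
    · rw [hstate η hη]
    · simpa only [Set.mem_ofPred_eq, hstate η hη] using hle
  have hR : ∫⁻ η, {ξ | (state D rule φ₀ ξ m).1 ≤ t}.indicator (fun ξ =>
      ((planAt D rule φ₀ ξ (m + 1)).length : ℝ≥0∞)) (splice σ ξ η) ∂seqLaw (markLaw lam) =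
      ∫⁻ η, ((planAt D rule φ₀ (splice σ ξ η) (m + 1)).length : ℝ≥0∞)
        ∂seqLaw (markLaw lam) := by
    refine lintegral_congr_ae ?_
    filter_upwards [hreg] with η hη
    rw [Set.indicator_of_mem]
    simpa only [Set.mem_ofPred_eq, hstate η hη] using hle
  rw [hL, hR]
  rcases planAt_cases (D := D) (rule := rule) (φ₀ := φ₀) ξ m with hnil | ⟨i, hi, hlast⟩
  -- Waiting: the duration is the first gap of `η`, with mean `1 / lam`, and the next path contains
  -- at least one target.
  · calc ∫⁻ η, c * ENNReal.ofReal ((state D rule φ₀ (splice σ ξ η) (m + 1)).1 - σ)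
          ∂seqLaw (markLaw lam)
        = ∫⁻ η, c * ENNReal.ofReal (η 0).1 ∂seqLaw (markLaw lam) := by
          refine lintegral_congr_ae ?_
          filter_upwards [hreg] with η hη
          have h0 := (planAt_splice (rule := rule) (φ₀ := φ₀) hv hT0.le hξ hη m).trans hnil
          rw [state_succ_of_nil h0, hstate η hη, hη.firstAfter_splice]
          have := arrival_splice_add σ ξ η 0
          rw [add_zero] at this
          simp only [← hσ, this, add_sub_cancel_left]
          simp [arrival]
      _ = c * ENNReal.ofReal (1 / lam) := by
          rw [lintegral_const_mul _ (by fun_prop), lintegral_interarrival hlam]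
      _ ≤ ∫⁻ _, 1 ∂seqLaw (markLaw lam) := by simpa using hc
      _ ≤ _ := by
          refine lintegral_mono_ae ?_
          filter_upwards [hreg] with η hη
          have h0 := (planAt_splice (rule := rule) (φ₀ := φ₀) hv hT0.le hξ hη m).trans hnil
          exact_mod_cast one_le_length_planAt_succ hv hρ hT
            (hξ.splice hη (state_nonneg hv hξ m)) h0
  -- The last selected target has already been generated, so the duration `s` does not depend on
  -- `η`; it is at most `(D - ρ) / v` because this target is outstanding at `σ`.
  · set s := arrival ξ i + (D - ρ) / v - σ with hs
    have hwin := (isTour_planAt hv hξ m).2.2 i hi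
    have hs0 : 0 ≤ s := by linarith [hwin.1]
    have hsT : s ≤ (D - ρ) / v := by linarith [hwin.2]
    have hsucc : ∀ η, Regular η →
        (state D rule φ₀ (splice σ ξ η) (m + 1)).1 = σ + s := by
      intro η hη
      have h0 := planAt_splice (rule := rule) (φ₀ := φ₀) hv hT0.le hξ hη m
      rw [state_succ_of_getLast (i := i) (by rw [h0]; exact hlast),
        arrival_splice_of_lt (hξ.lt_firstAfter_iff.2 hwin.2)]
      simp [hs]
    -- The last `w` time units of the iteration: long ago enough ones are dropped so that all
    -- remaining targets are due at least `ρ * π` after its end.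
    set w := min s ((D - ρ) / v - ρ * Real.pi) with hw
    have hw1 : w ≤ s := min_le_left _ _
    have hw2 : w ≤ (D - ρ) / v - ρ * Real.pi := min_le_right _ _
    have hy : s + ρ * Real.pi - (D - ρ) / v ≤ s - w := by linarith
    calc ∫⁻ η, c * ENNReal.ofReal ((state D rule φ₀ (splice σ ξ η) (m + 1)).1 - σ)
          ∂seqLaw (markLaw lam)
        = ∫⁻ _, c * ENNReal.ofReal s ∂seqLaw (markLaw lam) := by
          refine lintegral_congr_ae ?_
          filter_upwards [hreg] with η hη
          rw [hsucc η hη, add_sub_cancel_left]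
      _ ≤ meanLongest (markLaw lam) ρ w := by simpa using hc' s hs0 hsT
      _ = ∫⁻ η, longestChain ρ η (s - w) s ∂seqLaw (markLaw lam) := by
          rw [lintegral_longestChain hν hreg ρ (by linarith), sub_sub_cancel]
      _ ≤ _ := by
          refine lintegral_mono_ae ?_
          filter_upwards [hreg] with η hη
          exact longestChain_le_length_planAt_succ hv hρ hξ hη (by linarith) hy hsT
            (hsucc η hη)

end Iteration

/-! ### Sums over all iterations -/

section Sums

variable {v ρ D : ℝ} {rule : LongestPathRule v ρ} {φ₀ : Angle}

/-- An iteration with captures raises the number of due targets, as its last target was not due at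
its start; a waiting iteration raises the number of generated targets. This excludes infinitely many
iterations in finite time. -/
theorem le_firstAfter_add_firstAfter (hv : 0 < v) {ξ : ℕ → ℝ × Angle}
    (hξ : Regular ξ) (m : ℕ) :
    m ≤ firstAfter ξ ((state D rule φ₀ ξ m).1 - (D - ρ) / v) +
      firstAfter ξ (state D rule φ₀ ξ m).1 := by
  induction m with
  | zero => exact Nat.zero_le _
  | succ m ih =>
    have hlt : (state D rule φ₀ ξ m).1 ≤ (state D rule φ₀ ξ (m + 1)).1 :=
      (strictMono_state hv hξ).monotone m.le_succ
    have h1 := hξ.firstAfter_mono hlt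
    have h2 := hξ.firstAfter_mono (sub_le_sub_right hlt ((D - ρ) / v))
    rcases planAt_cases (D := D) (rule := rule) (φ₀ := φ₀) ξ m with h | ⟨i, hi, h⟩
    · have : firstAfter ξ (state D rule φ₀ ξ m).1 <
          firstAfter ξ (state D rule φ₀ ξ (m + 1)).1 :=
        hξ.lt_firstAfter_iff.2 (by rw [state_succ_of_nil h])
      omega
    · have h3 : i < firstAfter ξ ((state D rule φ₀ ξ (m + 1)).1 - (D - ρ) / v) :=
        hξ.lt_firstAfter_iff.2 (by rw [state_succ_of_getLast h]; simp)
      have h4 := ((isTour_planAt hv hξ m).2.2 i hi).1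
      rw [← not_le, ← hξ.lt_firstAfter_iff] at h4
      omega

theorem exists_lt_state (hv : 0 < v) (hT : 0 ≤ (D - ρ) / v) {ξ : ℕ → ℝ × Angle}
    (hξ : Regular ξ) (t : ℝ) : ∃ m, t < (state D rule φ₀ ξ m).1 := by
  by_contra! h
  -- Up to time `t` neither of the two counts exceeds `firstAfter ξ t`, so iteration `2 * firstAfter
  -- ξ t + 1` starts later.
  have h1 := le_firstAfter_add_firstAfter (D := D) (rule := rule) (φ₀ := φ₀) hv hξ
    (2 * firstAfter ξ t + 1)
  have h2 := hξ.firstAfter_mono (h (2 * firstAfter ξ t + 1))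
  have h3 := hξ.firstAfter_mono (s := (state D rule φ₀ ξ (2 * firstAfter ξ t + 1)).1 - (D - ρ) / v)
    (t := t) (by linarith [h (2 * firstAfter ξ t + 1)])
  omega

/-- The durations telescope up to the first state after time `t`. -/
theorem ofReal_le_tsum_duration (hv : 0 < v) (hT : 0 ≤ (D - ρ) / v) {ξ : ℕ → ℝ × Angle}
    (hξ : Regular ξ) (t : ℝ) :
    ENNReal.ofReal t ≤ ∑' m, {ξ | (state D rule φ₀ ξ m).1 ≤ t}.indicator (fun ξ =>
      ENNReal.ofReal ((state D rule φ₀ ξ (m + 1)).1 - (state D rule φ₀ ξ m).1)) ξ := by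
  classical
  have hex := exists_lt_state (rule := rule) (φ₀ := φ₀) hv hT hξ t
  set M := Nat.find hex
  have hM : t < (state D rule φ₀ ξ M).1 := Nat.find_spec hex
  have hlt : ∀ m < M, (state D rule φ₀ ξ m).1 ≤ t := fun m hm => not_lt.1 (Nat.find_min hex hm)
  refine le_trans ?_ (ENNReal.sum_le_tsum (Finset.range M))
  rw [Finset.sum_congr rfl (g := fun m => ENNReal.ofReal
    ((state D rule φ₀ ξ (m + 1)).1 - (state D rule φ₀ ξ m).1)) fun m hm =>
      Set.indicator_of_mem (s := {ξ | (state D rule φ₀ ξ m).1 ≤ t})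
        (hlt m (Finset.mem_range.1 hm)) _,
    ← ENNReal.ofReal_sum_of_nonneg fun m _ =>
      sub_nonneg.2 ((strictMono_state hv hξ).monotone m.le_succ),
    Finset.sum_range_sub fun m => (state D rule φ₀ ξ m).1]
  refine ENNReal.ofReal_le_ofReal ?_
  change t ≤ (state D rule φ₀ ξ M).1 - 0
  linarith

theorem arrival_le_of_getLast? (hρ : 0 ≤ ρ) {ξ : ℕ → ℝ × Angle} {l : List ℕ}
    (hl : l.IsChain (Follows ρ ξ)) {i n : ℕ} (hi : i ∈ l) (hn : l.getLast? = some n) :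
    arrival ξ i ≤ arrival ξ n := by
  have hp := (isChain_follows_iff hρ).1 hl
  obtain ⟨l', rfl⟩ := List.getLast?_eq_some_iff.1 hn
  rcases List.mem_append.1 hi with h | h
  · exact ((List.pairwise_append.1 hp).2.2 i h n (by simp)).1.le
  · rw [List.mem_singleton.1 h]

/-- The targets of an iteration reach the perimeter during this iteration. -/
theorem due_mem_of_mem_planAt (hv : 0 < v) (hρ : 0 ≤ ρ) {ξ : ℕ → ℝ × Angle} (hξ : Regular ξ)
    {m i : ℕ} (hi : i ∈ planAt D rule φ₀ ξ m) :
    (state D rule φ₀ ξ m).1 < arrival ξ i + (D - ρ) / v ∧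
      arrival ξ i + (D - ρ) / v ≤ (state D rule φ₀ ξ (m + 1)).1 := by
  have htour := isTour_planAt (D := D) (rule := rule) (φ₀ := φ₀) hv hξ m
  refine ⟨by linarith [(htour.2.2 i hi).1], ?_⟩
  rcases planAt_cases (D := D) (rule := rule) (φ₀ := φ₀) ξ m with h | ⟨n, -, h⟩
  · simp [h] at hi
  · rw [state_succ_of_getLast h]
    have := arrival_le_of_getLast? hρ htour.2.1 hi h
    simp only
    linarith

theorem nodup_planAt (hv : 0 < v) (hρ : 0 ≤ ρ) {ξ : ℕ → ℝ × Angle} (hξ : Regular ξ) (m : ℕ) :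
    (planAt D rule φ₀ ξ m).Nodup :=
  ((isChain_follows_iff hρ).1 (isTour_planAt hv hξ m).2.1).imp fun h hij => by
    subst hij; exact lt_irrefl _ h.1

/-- The due time of a selected target lies in the time interval of its iteration, and these
intervals are disjoint. -/
theorem disjoint_planAt (hv : 0 < v) (hρ : 0 ≤ ρ) {ξ : ℕ → ℝ × Angle} (hξ : Regular ξ) {m n i : ℕ}
    (hm : i ∈ planAt D rule φ₀ ξ m) (hn : i ∈ planAt D rule φ₀ ξ n) : m = n := by
  have h1 := due_mem_of_mem_planAt hv hρ hξ hm
  have h2 := due_mem_of_mem_planAt hv hρ hξ hn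
  have hmono := strictMono_state (D := D) (rule := rule) (φ₀ := φ₀) hv hξ
  have h3 : m < n + 1 := hmono.lt_iff_lt.1 (h1.1.trans_le h2.2)
  have h4 : n < m + 1 := hmono.lt_iff_lt.1 (h2.1.trans_le h1.2)
  omega

/-- The targets of all iterations that follow one begun up to time `t` have reached the perimeter
by time `t`, up to a number of targets that does not grow with `t` on average. -/
theorem tsum_length_planAt_le (hv : 0 < v) (hρ : 0 ≤ ρ)
    {ξ : ℕ → ℝ × Angle} (hξ : Regular ξ) {t : ℝ} {C : Set ℕ} (hC : C.Finite)
    (h : ∀ m, ∀ i ∈ planAt D rule φ₀ ξ m, arrival ξ i + (D - ρ) / v ≤ t → i ∈ C) :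
    ∑' m, {ξ | (state D rule φ₀ ξ m).1 ≤ t}.indicator (fun ξ =>
      ((planAt D rule φ₀ ξ (m + 1)).length : ℝ≥0∞)) ξ ≤
    C.ncard + ((firstAfter ξ (t + (D - ρ) / v) - firstAfter ξ (t - (D - ρ) / v) : ℕ) + 1) := by
  classical
  refine ENNReal.tsum_le_of_sum_range_le fun M => ?_
  -- Targets not yet due at `t` were generated after `t - (D - ρ) / v`. If the preceding iteration
  -- made captures, it ended by `t + (D - ρ) / v`, which bounds the generation time. If it waited,
  -- possibly for very long, the awaited target may be the first one after `t`.
  set B : Finset ℕ := hC.toFinset ∪ (Finset.Ico (firstAfter ξ (t - (D - ρ) / v))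
    (firstAfter ξ (t + (D - ρ) / v)) ∪ {firstAfter ξ t})
  set I := (Finset.range M).filter fun m => (state D rule φ₀ ξ m).1 ≤ t
  have h1 : ∑ m ∈ Finset.range M, {ξ | (state D rule φ₀ ξ m).1 ≤ t}.indicator (fun ξ =>
      ((planAt D rule φ₀ ξ (m + 1)).length : ℝ≥0∞)) ξ =
      ((I.biUnion fun m => (planAt D rule φ₀ ξ (m + 1)).toFinset).card : ℝ≥0∞) := by
    rw [Finset.card_biUnion, Finset.sum_filter, Nat.cast_sum]
    · refine Finset.sum_congr rfl fun m _ => ?_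
      rw [List.toFinset_card_of_nodup (nodup_planAt hv hρ hξ _), Set.indicator_apply]
      simp only [Set.mem_ofPred_eq]
      split_ifs <;> simp
    · intro m _ n _ hmn
      refine Finset.disjoint_left.2 fun i hi hj => hmn ?_
      have := disjoint_planAt hv hρ hξ (List.mem_toFinset.1 hi) (List.mem_toFinset.1 hj)
      omega
  have h2 : (I.biUnion fun m => (planAt D rule φ₀ ξ (m + 1)).toFinset) ⊆ B := by
    intro i hi
    obtain ⟨m, hm, hi⟩ := Finset.mem_biUnion.1 hi
    have hmt : (state D rule φ₀ ξ m).1 ≤ t := (Finset.mem_filter.1 hm).2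
    rw [List.mem_toFinset] at hi
    have hle := ((isTour_planAt hv hξ (m + 1)).2.2 i hi).2
    by_cases hdue : arrival ξ i + (D - ρ) / v ≤ t
    · exact Finset.mem_union_left _ (hC.mem_toFinset.2 (h _ i hi hdue))
    refine Finset.mem_union_right _ ?_
    have hge : firstAfter ξ (t - (D - ρ) / v) ≤ i := by
      rw [← not_lt, hξ.lt_firstAfter_iff]
      intro hcon
      exact hdue (by linarith)
    by_cases hit : arrival ξ i ≤ t + (D - ρ) / v
    · exact Finset.mem_union_left _ (Finset.mem_Ico.2 ⟨hge, hξ.lt_firstAfter_iff.2 hit⟩)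
    · refine Finset.mem_union_right _ (Finset.mem_singleton.2 ?_)
      rcases planAt_cases (D := D) (rule := rule) (φ₀ := φ₀) ξ m with h0 | ⟨n, hn, h0⟩
      · rw [state_succ_of_nil h0] at hle
        have h3 : i ≤ firstAfter ξ (state D rule φ₀ ξ m).1 := hξ.strictMono.le_iff_le.1 hle
        have h4 := hξ.firstAfter_mono hmt
        have h5 : ¬ i < firstAfter ξ t := by
          rw [hξ.lt_firstAfter_iff]; linarith
        omega
      · rw [state_succ_of_getLast h0] at hle
        have := ((isTour_planAt hv hξ m).2.2 n hn).2
        simp only at hle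
        linarith
  rw [h1]
  have h3 : B.card ≤ C.ncard +
      ((firstAfter ξ (t + (D - ρ) / v) - firstAfter ξ (t - (D - ρ) / v)) + 1) := by
    refine (Finset.card_union_le _ _).trans (add_le_add ?_ ?_)
    · rw [Set.ncard_eq_toFinset_card C hC]
    · refine (Finset.card_union_le _ _).trans ?_
      simp
  exact_mod_cast (Finset.card_le_card h2).trans h3

end Sums

/-! ### A motion that follows the policy -/

section Motion

variable {v ρ D : ℝ} {rule : LongestPathRule v ρ} {φ₀ : Angle}

/-- A target has radius `ρ` only at its due time, so it can meet the vehicle at no other time. -/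
theorem capturedBy_iff (hv : 0 < v) (hD : ρ ≤ D) (a : ℕ → ℝ) (θ : ℕ → Angle) (p : ℝ → Angle)
    (t : ℝ) (i : ℕ) :
    CapturedBy v ρ D a θ p t i ↔ due v ρ D (a i) ≤ t ∧ p (due v ρ D (a i)) = θ i := by
  have hdue : ∀ s, D - v * (s - a i) = ρ ↔ s = due v ρ D (a i) := by
    intro s
    unfold due
    constructor
    · intro h
      field_simp
      linarith
    · rintro rfl
      field_simp
      ring
  constructor
  · rintro ⟨s, -, hst, h⟩
    have h1 := congrArg Prod.fst h
    have h2 := congrArg Prod.snd h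
    simp only [location] at h1 h2
    obtain rfl := (hdue s).1 h1
    exact ⟨hst, h2.symm⟩
  · rintro ⟨h1, h2⟩
    refine ⟨_, ?_, h1, Prod.ext ((hdue _).2 rfl) h2.symm⟩
    have : 0 ≤ (D - ρ) / v := div_nonneg (by linarith) hv.le
    unfold due
    linarith

theorem orderEmbedding_eq_of_range {n j k : ℕ} (e : Fin n ↪o ℕ) (h : Set.range e = Set.Ico j k) :
    n = k - j ∧ ∀ i, e i = j + (i : ℕ) := by
  have hn : n = k - j := by
    have h1 : (Set.range e).ncard = n := by
      rw [← Set.image_univ, Set.ncard_image_of_injective _ e.injective, Set.ncard_univ]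
      simp
    rw [← h1, h, ← Finset.coe_Ico, Set.ncard_coe_finset, Nat.card_Ico]
  subst hn
  refine ⟨rfl, fun i => ?_⟩
  have hs : StrictMono fun i : Fin (k - j) => j + (i : ℕ) := fun a b hab => by
    have : (a : ℕ) < b := hab
    simp only
    omega
  have : (e : Fin (k - j) → ℕ) = fun i : Fin (k - j) => j + (i : ℕ) := by
    refine (StrictMono.range_inj e.strictMono hs).1 ?_
    rw [h]
    ext x
    simp only [Set.mem_Ico, Set.mem_range]
    constructor
    · rintro ⟨h1, h2⟩
      exact ⟨⟨x - j, by omega⟩, by simp only; omega⟩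
    · rintro ⟨y, rfl⟩
      have := y.2
      omega
  rw [this]

theorem outstanding_eq (hv : 0 < v) {ξ : ℕ → ℝ × Angle} (hξ : Regular ξ) (t : ℝ) :
    outstanding v ρ D (arrival ξ) (fun i => (ξ i).2) t =
      Set.Ico (firstAfter ξ (t - (D - ρ) / v)) (firstAfter ξ t) := by
  ext i
  rw [Set.mem_Ico, hξ.lt_firstAfter_iff, ← not_lt, hξ.lt_firstAfter_iff, not_le]
  simp only [outstanding, location, Set.mem_ofPred_eq]
  rw [and_comm, and_congr_left_iff]
  intro _
  rw [sub_lt_comm, lt_div_iff₀ hv]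
  constructor <;> intro h <;> linarith

/-- The range of the enumeration `e` forces it to be `i ↦ j + i`, and then end time and end angle
are determined as well. Every motion that follows the policy therefore runs through the states of
the recursion. -/
theorem IsLAIteration.eq_nextState (hv : 0 < v) {ξ : ℕ → ℝ × Angle} (hξ : Regular ξ)
    {p : ℝ → Angle} {t t' : ℝ}
    (h : IsLAIteration v ρ D rule (arrival ξ) (fun i => (ξ i).2) p t t') :
    (∀ i ∈ plan D rule ξ t (p t), p (arrival ξ i + (D - ρ) / v) = (ξ i).2) ∧
      (t', p t') = nextState D rule ξ (t, p t) := by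
  obtain ⟨n, e, l, hrange, hl, hcap, hlast, hnil⟩ := h
  rw [outstanding_eq hv hξ] at hrange
  obtain ⟨rfl, he⟩ := orderEmbedding_eq_of_range e hrange
  simp only [he] at hl hcap hlast
  have hplan : plan D rule ξ t (p t) =
      l.map fun i : Fin _ => firstAfter ξ (t - (D - ρ) / v) + (i : ℕ) := by
    rw [hl]; rfl
  have hcap' : ∀ i ∈ plan D rule ξ t (p t), p (arrival ξ i + (D - ρ) / v) = (ξ i).2 := by
    intro i hi
    rw [hplan] at hi
    obtain ⟨j, hj, rfl⟩ := List.mem_map.1 hi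
    exact hcap j hj
  refine ⟨hcap', ?_⟩
  rcases plan_cases (D := D) (rule := rule) ξ (t, p t) with h0 | ⟨i, hi, h0⟩
  · rw [nextState_of_nil h0]
    have hl0 : l = [] := by
      simp only [hplan, List.map_eq_nil_iff] at h0
      exact h0
    obtain ⟨hleast, hwait⟩ := hnil hl0
    have hlt := hleast.1.1
    have ht' : t' = arrival ξ (firstAfter ξ t) := by
      apply le_antisymm (hleast.2 ⟨hξ.lt_arrival_firstAfter t, _, rfl⟩)
      obtain ⟨i, hi⟩ := hleast.1.2
      rw [← hi]
      refine hξ.strictMono.monotone ?_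
      rw [← not_lt, hξ.lt_firstAfter_iff, hi]
      exact not_le.2 hlt
    rw [hwait t' ⟨hlt.le, le_rfl⟩, ← ht']
  · rw [nextState_of_getLast h0]
    have h1 := h0
    simp only [hplan, List.getLast?_map, Option.map_eq_some_iff] at h1
    obtain ⟨j, hj, rfl⟩ := h1
    have := hlast j hj
    rw [this, ← hcap' _ hi]
    rfl

theorem FollowsLA.capture_planAt (hv : 0 < v) {ξ : ℕ → ℝ × Angle} (hξ : Regular ξ)
    {p : ℝ → Angle} (h : FollowsLA v ρ D rule φ₀ (arrival ξ) (fun i => (ξ i).2) p) (m : ℕ) :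
    ∀ i ∈ planAt D rule φ₀ ξ m, p (arrival ξ i + (D - ρ) / v) = (ξ i).2 := by
  obtain ⟨-, h0, τ, hτ0, hτ⟩ := h
  have hstate : ∀ m, (τ m, p (τ m)) = state D rule φ₀ ξ m := by
    intro m
    induction m with
    | zero => rw [hτ0, h0]; rfl
    | succ m ih =>
      rw [((hτ m).eq_nextState hv hξ).2, ih]
      rfl
  have := ((hτ m).eq_nextState hv hξ).1
  rw [planAt, ← hstate m]
  exact this

theorem finite_capturedBy (hv : 0 < v) (hD : ρ ≤ D) {ξ : ℕ → ℝ × Angle} (hξ : Regular ξ)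
    (θ : ℕ → Angle) (p : ℝ → Angle) (t : ℝ) :
    {i | CapturedBy v ρ D (arrival ξ) θ p t i}.Finite := by
  refine (Set.finite_lt_nat (firstAfter ξ t)).subset fun i hi => ?_
  have h := ((capturedBy_iff hv hD _ _ _ _ _).1 hi).1
  refine hξ.lt_firstAfter_iff.2 (le_trans ?_ h)
  have : 0 ≤ (D - ρ) / v := div_nonneg (by linarith) hv.le
  unfold due
  linarith

theorem FollowsLA.tsum_length_planAt_le (hv : 0 < v) (hρ : 0 ≤ ρ) (hD : ρ ≤ D)
    {ξ : ℕ → ℝ × Angle} (hξ : Regular ξ) {p : ℝ → Angle}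
    (h : FollowsLA v ρ D rule φ₀ (arrival ξ) (fun i => (ξ i).2) p) (t : ℝ) :
    ∑' m, {ξ | (state D rule φ₀ ξ m).1 ≤ t}.indicator (fun ξ =>
      ((planAt D rule φ₀ ξ (m + 1)).length : ℝ≥0∞)) ξ ≤
    nCapt v ρ D (arrival ξ) (fun i => (ξ i).2) p t +
      ((firstAfter ξ (t + (D - ρ) / v) - firstAfter ξ (t - (D - ρ) / v) : ℕ) + 1) :=
  RIT.tsum_length_planAt_le hv hρ hξ
    (finite_capturedBy hv hD hξ _ p t) fun m i hi hdue =>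
      (capturedBy_iff hv hD _ (fun i => (ξ i).2) p t i).2 ⟨hdue, h.capture_planAt hv hξ m i hi⟩

/-- The targets captured by a vehicle on the perimeter form a chain. -/
theorem nCapt_le_longestChain (hv : 0 < v) (hρ : 0 ≤ ρ) (hD : ρ ≤ D) {ξ : ℕ → ℝ × Angle}
    (hξ : Regular ξ) {p : ℝ → Angle} (hp : IsPerimeterMotion ρ p) (t : ℝ) :
    (nCapt v ρ D (arrival ξ) (fun i => (ξ i).2) p t : ℝ≥0∞) ≤
      longestChain ρ ξ 0 (t - (D - ρ) / v) := by
  have hfin := finite_capturedBy hv hD hξ (fun i => (ξ i).2) p t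
  have hT : 0 ≤ (D - ρ) / v := div_nonneg (by linarith) hv.le
  rw [nCapt, Set.ncard_eq_toFinset_card _ hfin, ← Finset.length_sort (· ≤ ·)]
  have hmem : ∀ i ∈ hfin.toFinset.sort (· ≤ ·), arrival ξ i + (D - ρ) / v ≤ t ∧
      p (arrival ξ i + (D - ρ) / v) = (ξ i).2 := by
    intro i hi
    rw [Finset.mem_sort, hfin.mem_toFinset] at hi
    exact (capturedBy_iff hv hD _ (fun i => (ξ i).2) p t i).1 hi
  refine length_le_longestChain ⟨(isChain_follows_iff hρ).2 ?_, fun i hi => ?_⟩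
  · have hsort := (Finset.sortedLT_sort hfin.toFinset).pairwise
    refine hsort.imp_of_mem fun {i j} hi hj hij => ?_
    have h1 := hξ.strictMono hij
    refine ⟨h1, ?_⟩
    -- Due times differ by as much as generation times, so the speed limit between two captures is
    -- exactly the condition in `Follows`.
    have h2 := hp (arrival ξ i + (D - ρ) / v) (arrival ξ j + (D - ρ) / v)
      (by linarith [hξ.arrival_pos i]) (by linarith)
    rw [(hmem i hi).2, (hmem j hj).2] at h2
    linarith
  · exact ⟨hξ.arrival_pos i, by linarith [(hmem i hi).1]⟩

end Motion

/-! ### The mean number of captures of the Look-Ahead policy -/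

section MeanCaptures

variable {v ρ D lam : ℝ} {rule : LongestPathRule v ρ} {φ₀ : Angle}
  [IsProbabilityMeasure (markLaw lam)]

/-- The bound of `lintegral_duration_le` is summed over all iterations begun up to time `t`, whose
durations cover `[0, t]`. -/
theorem mul_lintegral_le_tsum (hlam : 0 < lam) (hv : 0 < v) (hρ : 0 < ρ)
    (hT : ρ * Real.pi ≤ (D - ρ) / v) {c : ℝ≥0∞} (hc : c * ENNReal.ofReal (1 / lam) ≤ 1)
    (hc' : ∀ s, 0 ≤ s → s ≤ (D - ρ) / v →
      c * ENNReal.ofReal s ≤ meanLongest (markLaw lam) ρ (min s ((D - ρ) / v - ρ * Real.pi)))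
    (t : ℝ) :
    c * ENNReal.ofReal t ≤
      ∫⁻ ξ, ∑' m, {ξ | (state D rule φ₀ ξ m).1 ≤ t}.indicator (fun ξ =>
        ((planAt D rule φ₀ ξ (m + 1)).length : ℝ≥0∞)) ξ ∂seqLaw (markLaw lam) := by
  have hT0 : 0 < (D - ρ) / v := lt_of_lt_of_le (mul_pos hρ Real.pi_pos) hT
  have hm : ∀ m, Measurable fun ξ => (state D rule φ₀ ξ m).1 := fun m =>
    measurable_fst.comp (measurable_state m)
  have hset : ∀ m, MeasurableSet {ξ | (state D rule φ₀ ξ m).1 ≤ t} := fun m =>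
    measurableSet_le (hm m) measurable_const
  have hdm : ∀ m, Measurable fun ξ => c * ENNReal.ofReal
      ((state D rule φ₀ ξ (m + 1)).1 - (state D rule φ₀ ξ m).1) := fun m =>
    ((hm (m + 1)).sub (hm m)).ennreal_ofReal.const_mul c
  calc c * ENNReal.ofReal t = ∫⁻ _, c * ENNReal.ofReal t ∂seqLaw (markLaw lam) := by simp
    _ ≤ ∫⁻ ξ, ∑' m, {ξ | (state D rule φ₀ ξ m).1 ≤ t}.indicator (fun ξ => c * ENNReal.ofReal
          ((state D rule φ₀ ξ (m + 1)).1 - (state D rule φ₀ ξ m).1)) ξ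
            ∂seqLaw (markLaw lam) := by
        refine lintegral_mono_ae ?_
        filter_upwards [ae_regular hlam] with ξ hξ
        simp only [Set.indicator_const_mul, ENNReal.tsum_mul_left]
        gcongr
        exact ofReal_le_tsum_duration hv hT0.le hξ t
    _ ≤ _ := by
        rw [lintegral_tsum fun m => ((hdm m).indicator (hset m)).aemeasurable,
          lintegral_tsum fun m =>
            ((measurable_length_planAt (m + 1)).indicator (hset m)).aemeasurable]
        exact ENNReal.tsum_le_tsum fun m => lintegral_duration_le hlam hv hρ hT hc hc' t m

/-- The rate `c = κ B / t` meets both requirements. For waiting iterations it is at most `lam`,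
because `B ≤ lam * t`; for the others it follows from subadditivity with `u = t - T`, where `u + T =
t`. -/
theorem ofReal_mul_meanLongest_le (hlam : 0 < lam) (hv : 0 < v) (hρ : 0 < ρ)
    (hT : ρ * Real.pi ≤ (D - ρ) / v) {t : ℝ} (ht : (D - ρ) / v ≤ t) :
    ENNReal.ofReal (1 - ρ * Real.pi / ((D - ρ) / v)) *
        meanLongest (markLaw lam) ρ (t - (D - ρ) / v) ≤
      ∫⁻ ξ, ∑' m, {ξ | (state D rule φ₀ ξ m).1 ≤ t}.indicator (fun ξ =>
        ((planAt D rule φ₀ ξ (m + 1)).length : ℝ≥0∞)) ξ ∂seqLaw (markLaw lam) := by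
  have hρπ : 0 < ρ * Real.pi := mul_pos hρ Real.pi_pos
  set T := (D - ρ) / v with hTdef
  have hT0 : 0 < T := lt_of_lt_of_le hρπ hT
  have ht0 : 0 < t := by linarith
  have hκ0 : 0 ≤ 1 - ρ * Real.pi / T := sub_nonneg.2 ((div_le_one hT0).2 hT)
  have hκ1 : 1 - ρ * Real.pi / T ≤ 1 := by
    have : 0 ≤ ρ * Real.pi / T := by positivity
    linarith
  set κ := 1 - ρ * Real.pi / T
  set B := meanLongest (markLaw lam) ρ (t - T)
  have ht1 : ENNReal.ofReal t ≠ 0 := by simpa using ht0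
  have ht2 : ENNReal.ofReal t ≠ ⊤ := ENNReal.ofReal_ne_top
  have key := mul_lintegral_le_tsum (rule := rule) (φ₀ := φ₀) hlam hv hρ hT
    (c := ENNReal.ofReal κ * B / ENNReal.ofReal t) ?_ ?_ t
  · rwa [ENNReal.div_mul_cancel ht1 ht2] at key
  · have hB : B ≤ ENNReal.ofReal (lam * t) :=
      (meanLongest_le hlam hρ.le (by linarith)).trans
        (ENNReal.ofReal_le_ofReal (by gcongr; linarith))
    calc ENNReal.ofReal κ * B / ENNReal.ofReal t * ENNReal.ofReal (1 / lam)
        ≤ 1 * ENNReal.ofReal (lam * t) / ENNReal.ofReal t * ENNReal.ofReal (1 / lam) := by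
          gcongr
          exact ENNReal.ofReal_le_one.2 hκ1
      _ = 1 := by
          rw [one_mul, ← ENNReal.ofReal_div_of_pos ht0, ← ENNReal.ofReal_mul (by positivity),
            mul_div_assoc, div_self ht0.ne', mul_one, mul_one_div_cancel hlam.ne',
            ENNReal.ofReal_one]
  · intro s hs hsT
    have hx0 : 0 ≤ min s (T - ρ * Real.pi) := le_min hs (by linarith)
    have hxT : min s (T - ρ * Real.pi) ≤ T := (min_le_left _ _).trans hsT
    -- The loss factor arises here: `T - ρ * π = κ * T`, and `s ≤ T`, so `κ * s` is below both terms
    -- of the minimum.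
    have hx : κ * s ≤ min s (T - ρ * Real.pi) := by
      refine le_min (by nlinarith) ?_
      calc κ * s ≤ κ * T := by gcongr
        _ = T - ρ * Real.pi := by simp only [κ]; field_simp
    have h1 := meanLongest_mul_le (memoryless_markLaw hlam) (ae_regular hlam) hρ.le hx0 hxT
      (u := t - T) (by linarith)
    rw [sub_add_cancel] at h1
    calc ENNReal.ofReal κ * B / ENNReal.ofReal t * ENNReal.ofReal s
        = B * ENNReal.ofReal (κ * s) / ENNReal.ofReal t := by
          rw [ENNReal.ofReal_mul hκ0]
          simp only [div_eq_mul_inv]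
          ring
      _ ≤ B * ENNReal.ofReal (min s (T - ρ * Real.pi)) / ENNReal.ofReal t := by gcongr
      _ ≤ meanLongest (markLaw lam) ρ (min s (T - ρ * Real.pi)) := by
          refine ENNReal.div_le_of_le_mul' h1

theorem lintegral_firstAfter_sub (hlam : 0 < lam) {s t : ℝ} (hs : 0 ≤ s) (hst : s ≤ t) :
    ∫⁻ ξ, ((firstAfter ξ t - firstAfter ξ s : ℕ) : ℝ≥0∞) ∂seqLaw (markLaw lam) =
      ENNReal.ofReal (lam * (t - s)) := by
  have hN : ∀ t, Measurable fun ξ : ℕ → ℝ × Angle => (firstAfter ξ t : ℝ≥0∞) := fun t =>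
    measurable_from_nat.comp (measurable_firstAfter measurable_id measurable_const)
  have h : ∫⁻ ξ, (firstAfter ξ t : ℝ≥0∞) ∂seqLaw (markLaw lam) =
      ∫⁻ ξ, ((firstAfter ξ s : ℝ≥0∞) + ((firstAfter ξ t - firstAfter ξ s : ℕ) : ℝ≥0∞))
        ∂seqLaw (markLaw lam) := by
    refine lintegral_congr_ae ?_
    filter_upwards [ae_regular hlam] with ξ hξ
    have := hξ.firstAfter_mono hst
    rw [← Nat.cast_add, Nat.add_sub_cancel' this]
  rw [lintegral_add_left (hN s), lintegral_firstAfter hlam hs,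
    lintegral_firstAfter hlam (hs.trans hst)] at h
  rw [mul_sub, ENNReal.ofReal_sub _ (by positivity), h,
    ENNReal.add_sub_cancel_left ENNReal.ofReal_ne_top]

end MeanCaptures

/-! ### Random targets -/

section Random

variable {Ω : Type*} {a : ℕ → Ω → ℝ} {θ : ℕ → Ω → Angle}

/-- The random sequence of interarrival times and angles. -/
def marks (a : ℕ → Ω → ℝ) (θ : ℕ → Ω → Angle) (ω : Ω) (i : ℕ) : ℝ × Angle :=
  (interarrival a i ω, θ i ω)

theorem arrival_marks (ω : Ω) : arrival (marks a θ ω) = fun i => a i ω := by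
  ext i
  induction i with
  | zero => simp [arrival, marks, interarrival]
  | succ i ih => rw [arrival_succ, ih]; simp [marks, interarrival]

variable {v ρ D : ℝ}

/-- A target counts as captured or escaped from its due time on, whatever the motion. The
denominator of the capture fraction is thus the same for all motions. -/
theorem nCapt_add_nEsc (hv : 0 < v) (hD : ρ ≤ D) {ω : Ω} (hω : Regular (marks a θ ω))
    (p : ℝ → Angle) (t : ℝ) :
    nCapt v ρ D (fun i => a i ω) (fun i => θ i ω) p t +
      nEsc v ρ D (fun i => a i ω) (fun i => θ i ω) p t =
        firstAfter (marks a θ ω) (t - (D - ρ) / v) := by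
  have hiff : ∀ i, due v ρ D (a i ω) ≤ t ↔ i < firstAfter (marks a θ ω) (t - (D - ρ) / v) := by
    intro i
    rw [hω.lt_firstAfter_iff, arrival_marks, due, le_sub_iff_add_le]
  have hU : {i | CapturedBy v ρ D (fun i => a i ω) (fun i => θ i ω) p t i} ∪
      {i | EscapedBy v ρ D (fun i => a i ω) (fun i => θ i ω) p t i} =
      Set.Iio (firstAfter (marks a θ ω) (t - (D - ρ) / v)) := by
    ext i
    simp only [Set.mem_union, Set.mem_ofPred_eq, EscapedBy, Set.mem_Iio, ← hiff]
    have := capturedBy_iff hv hD (fun i => a i ω) (fun i => θ i ω) p t i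
    tauto
  have hfin := Set.finite_Iio (firstAfter (marks a θ ω) (t - (D - ρ) / v))
  rw [← hU] at hfin
  rw [nCapt, nEsc, ← Set.ncard_union_eq _ (hfin.subset Set.subset_union_left)
    (hfin.subset Set.subset_union_right), hU, ← Finset.coe_Iio, Set.ncard_coe_finset, Nat.card_Iio]
  exact Set.disjoint_left.2 fun i h1 h2 => h2.2 h1

theorem nCapt_eq_sum (hv : 0 < v) (hD : ρ ≤ D) {ω : Ω} (hω : Regular (marks a θ ω))
    (p : ℝ → Angle) (t : ℝ) :
    (nCapt v ρ D (fun i => a i ω) (fun i => θ i ω) p t : ℝ) =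
      ∑ i ∈ Finset.range (firstAfter (marks a θ ω) (t - (D - ρ) / v)),
        {ω | p (due v ρ D (a i ω)) = θ i ω}.indicator (fun _ => (1 : ℝ)) ω := by
  classical
  have : {i | CapturedBy v ρ D (fun i => a i ω) (fun i => θ i ω) p t i} =
      (((Finset.range (firstAfter (marks a θ ω) (t - (D - ρ) / v))).filter
        fun i => p (due v ρ D (a i ω)) = θ i ω : Finset ℕ) : Set ℕ) := by
    ext i
    rw [Set.mem_ofPred_eq, capturedBy_iff hv hD, Finset.coe_filter, Set.mem_ofPred_eq,
      Finset.mem_range, hω.lt_firstAfter_iff, arrival_marks, le_sub_iff_add_le]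
    rfl
  rw [nCapt, this, Set.ncard_coe_finset, Finset.card_filter, Nat.cast_sum]
  refine Finset.sum_congr rfl fun i _ => ?_
  rw [Set.indicator_apply]
  simp

variable [MeasurableSpace Ω] {μ : Measure Ω} {lam : ℝ}

theorem IsTargetProcess.measurable_interarrival (h : IsTargetProcess μ lam a θ) (i : ℕ) :
    Measurable (interarrival a i) := by
  rcases i with _ | i
  · exact h.measurable_time 0
  · exact (h.measurable_time (i + 1)).sub (h.measurable_time i)

theorem IsTargetProcess.measurable_marks (h : IsTargetProcess μ lam a θ) :
    Measurable (marks a θ) :=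
  measurable_pi_lambda _ fun i => (h.measurable_interarrival i).prodMk (h.measurable_angle i)

theorem IsTargetProcess.map_marks [IsProbabilityMeasure μ] [IsProbabilityMeasure (markLaw lam)]
    (h : IsTargetProcess μ lam a θ) : μ.map (marks a θ) = seqLaw (markLaw lam) := by
  have h1 := h.indep.map_fun_eq_infinitePi_map
    fun i => (h.measurable_interarrival i).prodMk (h.measurable_angle i)
  refine h1.trans ?_
  unfold seqLaw
  congr 1
  ext1 i
  exact h.law i

theorem IsTargetProcess.ae_regular [IsProbabilityMeasure μ] [IsProbabilityMeasure (markLaw lam)]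
    (h : IsTargetProcess μ lam a θ) (hlam : 0 < lam) : ∀ᵐ ω ∂μ, Regular (marks a θ ω) := by
  have := RIT.ae_regular hlam
  rw [← h.map_marks] at this
  exact ae_of_ae_map h.measurable_marks.aemeasurable this

theorem IsPerimeterMotion.continuous (hρ : 0 < ρ) {p : ℝ → Angle} (h : IsPerimeterMotion ρ p) :
    Continuous fun t => p (max t 0) := by
  have hlip : ∀ s t : ℝ, 0 ≤ s → s ≤ t → dist (p t) (p s) ≤ ρ⁻¹ * (t - s) := by
    intro s t hs hst
    rw [dist_eq_norm, inv_mul_eq_div, le_div_iff₀ hρ, mul_comm]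
    exact h s t hs hst
  have hlip' : ∀ s t : ℝ, 0 ≤ s → 0 ≤ t → dist (p t) (p s) ≤ ρ⁻¹ * dist t s := by
    intro s t hs ht
    rcases le_total s t with hst | hst
    · rw [Real.dist_eq, abs_of_nonneg (by linarith)]
      exact hlip s t hs hst
    · rw [Real.dist_eq, abs_of_nonpos (by linarith), dist_comm, neg_sub]
      exact hlip t s ht hst
  have hl : LipschitzOnWith (Real.toNNReal ρ⁻¹) p (Set.Ici 0) :=
    LipschitzOnWith.of_dist_le_mul fun x hx y hy => by
      rw [Real.coe_toNNReal _ (inv_nonneg.2 hρ.le)]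
      exact hlip' y x hy hx
  exact hl.continuousOn.comp_continuous (by fun_prop) fun t => le_max_right t 0

/-- A lower bound for a Bochner integral needs measurability, since a non-integrable function has
integral zero. The vehicle position is evaluated at random due times, which is measurable because
paths are continuous and positions at fixed times are measurable. -/
theorem aemeasurable_nCapt [IsProbabilityMeasure μ] [IsProbabilityMeasure (markLaw lam)]
    (h : IsTargetProcess μ lam a θ) (hlam : 0 < lam) (hv : 0 < v) (hρ : 0 < ρ) (hD : ρ ≤ D)
    {p : Ω → ℝ → Angle} (hpm : ∀ t, Measurable fun ω => p ω t)
    (hp : ∀ᵐ ω ∂μ, IsPerimeterMotion ρ (p ω)) (t : ℝ) :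
    AEMeasurable (fun ω => (nCapt v ρ D (fun i => a i ω) (fun i => θ i ω) (p ω) t : ℝ)) μ := by
  classical
  obtain ⟨N, hN, hNm, hN0⟩ := exists_measurable_superset_of_null hp
  -- The motion is modified on a null set, and frozen at negative times where the speed limit says
  -- nothing, to be continuous for every `ω`.
  set q : ℝ → Ω → Angle := fun t => N.piecewise (fun _ => 0) fun ω => p ω (max t 0) with hq
  have hqm : Measurable (Function.uncurry q) := by
    refine measurable_uncurry_of_continuous_of_measurable (fun ω => ?_) fun t =>
      measurable_const.piecewise hNm (hpm _)
    by_cases hω : ω ∈ N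
    · simpa [hq, hω] using continuous_const
    · have hω' : IsPerimeterMotion ρ (p ω) := by
        by_contra hcon
        exact hω (hN hcon)
      simpa [hq, hω] using hω'.continuous hρ
  have hdue : ∀ i, Measurable fun ω => due v ρ D (a i ω) := fun i =>
    (h.measurable_time i).add_const _
  have hS : ∀ i, MeasurableSet {ω | q (due v ρ D (a i ω)) ω = θ i ω} := fun i =>
    measurableSet_eq_fun (hqm.comp ((hdue i).prodMk measurable_id)) (h.measurable_angle i)
  have hQ : Measurable fun ω => firstAfter (marks a θ ω) (t - (D - ρ) / v) :=
    measurable_firstAfter h.measurable_marks measurable_const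
  refine ⟨fun ω => ∑ i ∈ Finset.range (firstAfter (marks a θ ω) (t - (D - ρ) / v)),
    {ω | q (due v ρ D (a i ω)) ω = θ i ω}.indicator (fun _ => (1 : ℝ)) ω, ?_, ?_⟩
  · exact measurable_of_countable_pieces (fun k => hQ (measurableSet_singleton k))
      (g := fun k ω => ∑ i ∈ Finset.range k,
        {ω | q (due v ρ D (a i ω)) ω = θ i ω}.indicator (fun _ => (1 : ℝ)) ω)
      fun k => Finset.measurable_sum _ fun i _ => measurable_const.indicator (hS i)
  · have hNae : ∀ᵐ ω ∂μ, ω ∉ N := measure_eq_zero_iff_ae_notMem.1 hN0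
    filter_upwards [h.ae_regular hlam, hNae] with ω hω hωN
    rw [nCapt_eq_sum hv hD hω]
    refine Finset.sum_congr rfl fun i _ => ?_
    have hpos : 0 ≤ due v ρ D (a i ω) := by
      have h1 := hω.arrival_pos i
      rw [arrival_marks] at h1
      have h2 : 0 ≤ (D - ρ) / v := div_nonneg (by linarith) hv.le
      unfold due
      linarith
    simp [Set.indicator_apply, hq, hωN, hpos]

end Random

/-! ### Comparison of the capture fractions -/

/-- The difference is `n / Q` times `1 - Q / x`, and `n / Q ≤ 1`. This trades the random denominator
for `x = lam * t` at a cost independent of `n`. -/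
theorem abs_div_sub_div_le {n Q x : ℝ} (hn : 0 ≤ n) (hnQ : n ≤ Q) :
    |n / Q - n / x| ≤ |1 - Q / x| := by
  rcases (hn.trans hnQ).eq_or_lt with hQ | hQ
  · obtain rfl : n = 0 := le_antisymm (hQ ▸ hnQ) hn
    simp
  · have : n / Q - n / x = n / Q * (1 - Q / x) := by field_simp
    rw [this, abs_mul, abs_of_nonneg (by positivity)]
    exact mul_le_of_le_one_left (abs_nonneg _) ((div_le_one hQ).2 hnQ)

theorem mul_limsup_le_limsup {f g r : ℝ → ℝ} {κ : ℝ} (hκ : 0 ≤ κ) (hf0 : ∀ t, 0 ≤ f t)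
    (hf1 : ∀ t, f t ≤ 1) (hg1 : ∀ t, g t ≤ 1)
    (hr : Tendsto r atTop (𝓝 0)) (h : ∀ᶠ t in atTop, κ * f t ≤ g t + r t) :
    κ * limsup f atTop ≤ limsup g atTop := by
  have hgb : IsBoundedUnder (· ≤ ·) atTop g := isBoundedUnder_of ⟨1, hg1⟩
  have hfc : IsCoboundedUnder (· ≤ ·) atTop f :=
    (isBoundedUnder_of ⟨0, hf0⟩ : IsBoundedUnder (· ≥ ·) atTop f).isCoboundedUnder_le
  have hfb : IsBoundedUnder (· ≤ ·) atTop f := isBoundedUnder_of ⟨1, hf1⟩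
  refine le_of_forall_pos_le_add fun ε hε => ?_
  have h1 : ∀ᶠ t in atTop, κ * f t ≤ limsup g atTop + ε := by
    filter_upwards [h, eventually_lt_of_limsup_lt (lt_add_of_pos_right _ (half_pos hε)) hgb,
      hr.eventually_lt_const (half_pos hε)] with t h1 h2 h3
    linarith
  -- Division by `κ` is impossible for `κ = 0`, where the eventual bound itself gives the claim.
  rcases hκ.eq_or_lt with rfl | hκ
  · obtain ⟨t, ht⟩ := h1.exists
    linarith
  · rw [← le_div_iff₀' hκ]
    refine limsup_le_of_le hfc ?_
    filter_upwards [h1] with t ht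
    rwa [le_div_iff₀' hκ]

theorem nCapt_div_nonneg {Ω : Type*} {v ρ D : ℝ} {a : ℕ → Ω → ℝ} {θ : ℕ → Ω → Angle}
    (p : ℝ → Angle) (t : ℝ) (ω : Ω) :
    0 ≤ (nCapt v ρ D (fun i => a i ω) (fun i => θ i ω) p t : ℝ) /
      ((nCapt v ρ D (fun i => a i ω) (fun i => θ i ω) p t : ℝ) +
        (nEsc v ρ D (fun i => a i ω) (fun i => θ i ω) p t : ℝ)) := by
  positivity

theorem nCapt_div_le_one {Ω : Type*} {v ρ D : ℝ} {a : ℕ → Ω → ℝ} {θ : ℕ → Ω → Angle}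
    (p : ℝ → Angle) (t : ℝ) (ω : Ω) :
    (nCapt v ρ D (fun i => a i ω) (fun i => θ i ω) p t : ℝ) /
      ((nCapt v ρ D (fun i => a i ω) (fun i => θ i ω) p t : ℝ) +
        (nEsc v ρ D (fun i => a i ω) (fun i => θ i ω) p t : ℝ)) ≤ 1 :=
  div_le_one_of_le₀ (le_add_of_nonneg_right (Nat.cast_nonneg _)) (by positivity)

section Comparison

variable {Ω : Type*} [MeasurableSpace Ω] {μ : Measure Ω} [IsProbabilityMeasure μ]
  {v ρ D lam : ℝ} [IsProbabilityMeasure (markLaw lam)] {a : ℕ → Ω → ℝ} {θ : ℕ → Ω → Angle}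

theorem integral_nCapt_div_le_one (p : Ω → ℝ → Angle) (t : ℝ) :
    ∫ ω, (nCapt v ρ D (fun i => a i ω) (fun i => θ i ω) (p ω) t : ℝ) /
      ((nCapt v ρ D (fun i => a i ω) (fun i => θ i ω) (p ω) t : ℝ) +
        (nEsc v ρ D (fun i => a i ω) (fun i => θ i ω) (p ω) t : ℝ)) ∂μ ≤ 1 := by
  calc _ ≤ ∫ _, (1 : ℝ) ∂μ :=
        integral_mono_of_nonneg (ae_of_all _ fun ω => nCapt_div_nonneg _ _ _) (integrable_const _)
          (ae_of_all _ fun ω => nCapt_div_le_one _ _ _)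
    _ = 1 := by simp

theorem IsTargetProcess.integrable_comp (h : IsTargetProcess μ lam a θ)
    {f : (ℕ → ℝ × Angle) → ℝ} (hf : Integrable f (seqLaw (markLaw lam))) :
    Integrable (fun ω => f (marks a θ ω)) μ := by
  rw [← h.map_marks] at hf
  exact hf.comp_measurable h.measurable_marks

theorem IsTargetProcess.integral_comp (h : IsTargetProcess μ lam a θ)
    {f : (ℕ → ℝ × Angle) → ℝ} (hf : Integrable f (seqLaw (markLaw lam))) :
    ∫ ω, f (marks a θ ω) ∂μ = ∫ ξ, f ξ ∂seqLaw (markLaw lam) := by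
  have hf1 := hf.1
  rw [← h.map_marks] at hf1 ⊢
  rw [integral_map h.measurable_marks.aemeasurable hf1]

theorem IsTargetProcess.lintegral_comp (h : IsTargetProcess μ lam a θ)
    {f : (ℕ → ℝ × Angle) → ℝ≥0∞} (hf : Measurable f) :
    ∫⁻ ω, f (marks a θ ω) ∂μ = ∫⁻ ξ, f ξ ∂seqLaw (markLaw lam) := by
  rw [← h.map_marks, lintegral_map hf h.measurable_marks]

theorem integrable_abs_one_sub (hlam : 0 < lam) (t x : ℝ) :
    Integrable (fun ξ => |1 - (firstAfter ξ t : ℝ) / x|) (seqLaw (markLaw lam)) :=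
  ((integrable_const _).sub ((integrable_firstAfter hlam _).div_const _)).abs

/-- No motion along the perimeter captures more targets than a longest chain has on average. -/
theorem integral_nCapt_div_le (h : IsTargetProcess μ lam a θ) (hlam : 0 < lam) (hv : 0 < v)
    (hρ : 0 < ρ) (hD : ρ ≤ D) {p : Ω → ℝ → Angle} (hp : ∀ᵐ ω ∂μ, IsPerimeterMotion ρ (p ω))
    {t : ℝ} (ht : 0 < t) (htT : (D - ρ) / v ≤ t) :
    ∫ ω, (nCapt v ρ D (fun i => a i ω) (fun i => θ i ω) (p ω) t : ℝ) /
      ((nCapt v ρ D (fun i => a i ω) (fun i => θ i ω) (p ω) t : ℝ) +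
        (nEsc v ρ D (fun i => a i ω) (fun i => θ i ω) (p ω) t : ℝ)) ∂μ ≤
    (meanLongest (markLaw lam) ρ (t - (D - ρ) / v)).toReal / (lam * t) +
      ∫ ξ, |1 - (firstAfter ξ (t - (D - ρ) / v) : ℝ) / (lam * t)| ∂seqLaw (markLaw lam) := by
  have hm := measurable_longestChain ρ 0 (t - (D - ρ) / v)
  have hfin : ∫⁻ ξ, longestChain ρ ξ 0 (t - (D - ρ) / v) ∂seqLaw (markLaw lam) ≠ ⊤ :=
    ((meanLongest_le hlam hρ.le (by linarith)).trans_lt ENNReal.ofReal_lt_top).ne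
  have hint : Integrable (fun ξ => (longestChain ρ ξ 0 (t - (D - ρ) / v)).toReal)
      (seqLaw (markLaw lam)) := integrable_toReal_of_lintegral_ne_top hm.aemeasurable hfin
  have hmean : ∫ ξ, (longestChain ρ ξ 0 (t - (D - ρ) / v)).toReal ∂seqLaw (markLaw lam) =
      (meanLongest (markLaw lam) ρ (t - (D - ρ) / v)).toReal :=
    integral_toReal hm.aemeasurable (ae_lt_top hm hfin)
  have habs := integrable_abs_one_sub hlam (t - (D - ρ) / v) (lam * t)
  have hsum : Integrable (fun ξ => (longestChain ρ ξ 0 (t - (D - ρ) / v)).toReal / (lam * t) +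
      |1 - (firstAfter ξ (t - (D - ρ) / v) : ℝ) / (lam * t)|) (seqLaw (markLaw lam)) :=
    (hint.div_const (lam * t)).add habs
  rw [← hmean, ← integral_div, ← integral_add (hint.div_const _) habs, ← h.integral_comp hsum]
  refine integral_mono_of_nonneg (ae_of_all _ fun ω => nCapt_div_nonneg _ _ _)
    (h.integrable_comp hsum) ?_
  filter_upwards [h.ae_regular hlam, hp] with ω hω hpω
  have h1 := nCapt_add_nEsc hv hD hω (p ω) t
  have h2 := nCapt_le_longestChain hv hρ.le hD hω hpω t
  rw [arrival_marks] at h2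
  have h3 : longestChain ρ (marks a θ ω) 0 (t - (D - ρ) / v) ≠ ⊤ :=
    ((longestChain_le_firstAfter hρ.le hω _ _).trans_lt (ENNReal.natCast_lt_top _)).ne
  have h4 : (nCapt v ρ D (fun i => a i ω) (fun i => θ i ω) (p ω) t : ℝ) ≤
      (longestChain ρ (marks a θ ω) 0 (t - (D - ρ) / v)).toReal := by
    rw [← ENNReal.toReal_natCast]
    exact ENNReal.toReal_mono h3 h2
  have h5 : (nCapt v ρ D (fun i => a i ω) (fun i => θ i ω) (p ω) t : ℝ) ≤
      firstAfter (marks a θ ω) (t - (D - ρ) / v) := by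
    rw [← h1]; exact_mod_cast Nat.le_add_right _ _
  have h6 := (abs_le.1 (abs_div_sub_div_le (x := lam * t) (Nat.cast_nonneg _) h5)).2
  have h7 := div_le_div_of_nonneg_right h4 (by positivity : 0 ≤ lam * t)
  rw [← Nat.cast_add, h1]
  linarith

/-- A lower bound for the mean fraction of targets captured by the Look-Ahead policy. -/
theorem le_integral_nCapt_div (h : IsTargetProcess μ lam a θ) (hlam : 0 < lam) (hv : 0 < v)
    (hρ : 0 < ρ) (hT : ρ * Real.pi ≤ (D - ρ) / v) {rule : LongestPathRule v ρ} {φ₀ : Angle}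
    {p : Ω → ℝ → Angle} (hpm : ∀ t, Measurable fun ω => p ω t)
    (hp : ∀ᵐ ω ∂μ, FollowsLA v ρ D rule φ₀ (fun i => a i ω) (fun i => θ i ω) (p ω))
    {t : ℝ} (htT : (D - ρ) / v ≤ t) :
    (1 - ρ * Real.pi / ((D - ρ) / v)) *
        (meanLongest (markLaw lam) ρ (t - (D - ρ) / v)).toReal / (lam * t) ≤
      ∫ ω, (nCapt v ρ D (fun i => a i ω) (fun i => θ i ω) (p ω) t : ℝ) /
        ((nCapt v ρ D (fun i => a i ω) (fun i => θ i ω) (p ω) t : ℝ) +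
          (nEsc v ρ D (fun i => a i ω) (fun i => θ i ω) (p ω) t : ℝ)) ∂μ +
      ∫ ξ, |1 - (firstAfter ξ (t - (D - ρ) / v) : ℝ) / (lam * t)| ∂seqLaw (markLaw lam) +
      (lam * (2 * ((D - ρ) / v)) + 1) / (lam * t) := by
  have hT0 : 0 < (D - ρ) / v := lt_of_lt_of_le (mul_pos hρ Real.pi_pos) hT
  have ht0 : 0 < t := by linarith
  have hD : ρ ≤ D := by
    have := (div_pos_iff_of_pos_right hv).1 hT0
    linarith
  have hκ0 : 0 ≤ 1 - ρ * Real.pi / ((D - ρ) / v) := sub_nonneg.2 ((div_le_one hT0).2 hT)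
  set T := (D - ρ) / v with hTdef
  set X : Ω → ℝ := fun ω => (nCapt v ρ D (fun i => a i ω) (fun i => θ i ω) (p ω) t : ℝ) with hX
  have hXm : AEMeasurable X μ :=
    aemeasurable_nCapt h hlam hv hρ hD hpm (hp.mono fun ω hω => hω.1) t
  have hQint : Integrable (fun ω => (firstAfter (marks a θ ω) (t - T) : ℝ)) μ :=
    h.integrable_comp (integrable_firstAfter hlam _)
  have hXQ : ∀ᵐ ω ∂μ, X ω ≤ firstAfter (marks a θ ω) (t - T) := by
    filter_upwards [h.ae_regular hlam] with ω hω
    simp only [hX]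
    rw [← nCapt_add_nEsc hv hD hω (p ω) t]
    exact_mod_cast Nat.le_add_right _ _
  have hXint : Integrable X μ := by
    refine hQint.mono' hXm.aestronglyMeasurable ?_
    filter_upwards [hXQ] with ω hω
    rwa [Real.norm_of_nonneg (Nat.cast_nonneg _)]
  -- The constant is the mean number `lam * (2 * T)` of targets generated in `(t - T, t + T]`, plus
  -- the one target for which the vehicle may be waiting at time `t`.
  have hlower : (1 - ρ * Real.pi / T) * (meanLongest (markLaw lam) ρ (t - T)).toReal ≤
      ∫ ω, X ω ∂μ + (lam * (2 * T) + 1) := by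
    have hNm : ∀ t, Measurable fun ξ : ℕ → ℝ × Angle => firstAfter ξ t := fun t =>
      measurable_firstAfter measurable_id measurable_const
    have hdm : Measurable fun ξ : ℕ → ℝ × Angle =>
        (((firstAfter ξ (t + T) - firstAfter ξ (t - T) : ℕ) : ℝ≥0∞) + 1) :=
      (measurable_from_nat.comp ((hNm _).sub (hNm _))).add_const _
    have hHm : Measurable fun ξ => ∑' m, {ξ | (state D rule φ₀ ξ m).1 ≤ t}.indicator (fun ξ =>
        ((planAt D rule φ₀ ξ (m + 1)).length : ℝ≥0∞)) ξ :=
      Measurable.tsum fun m => (measurable_length_planAt (m + 1)).indicator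
        (measurableSet_le (measurable_fst.comp (measurable_state m)) measurable_const)
    have h1 := ofReal_mul_meanLongest_le (rule := rule) (φ₀ := φ₀) hlam hv hρ hT htT
    rw [← hTdef, ← h.lintegral_comp hHm] at h1
    have h2 : ∫⁻ ω, ∑' m, {ξ | (state D rule φ₀ ξ m).1 ≤ t}.indicator (fun ξ =>
        ((planAt D rule φ₀ ξ (m + 1)).length : ℝ≥0∞)) (marks a θ ω) ∂μ ≤
        ∫⁻ ω, (ENNReal.ofReal (X ω) + (((firstAfter (marks a θ ω) (t + T) -
          firstAfter (marks a θ ω) (t - T) : ℕ) : ℝ≥0∞) + 1)) ∂μ := by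
      refine lintegral_mono_ae ?_
      filter_upwards [h.ae_regular hlam, hp] with ω hω hpω
      have hpω' : FollowsLA v ρ D rule φ₀ (arrival (marks a θ ω))
          (fun i => (marks a θ ω i).2) (p ω) := by
        rw [arrival_marks]; exact hpω
      have := hpω'.tsum_length_planAt_le hv hρ.le hD hω t
      rw [arrival_marks] at this
      rw [hX, ENNReal.ofReal_natCast]
      exact this
    have hdm' : Measurable fun ω => (((firstAfter (marks a θ ω) (t + T) -
        firstAfter (marks a θ ω) (t - T) : ℕ) : ℝ≥0∞) + 1) := hdm.comp h.measurable_marks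
    rw [lintegral_add_right _ hdm', h.lintegral_comp hdm,
      lintegral_add_right _ measurable_const,
      lintegral_firstAfter_sub hlam (by linarith) (by linarith),
      ← ofReal_integral_eq_lintegral_ofReal hXint (ae_of_all _ fun ω => Nat.cast_nonneg _)] at h2
    have h3 := h1.trans h2
    have hX0 : 0 ≤ ∫ ω, X ω ∂μ := integral_nonneg fun ω => Nat.cast_nonneg _
    have hle : 0 ≤ lam * (t + T - (t - T)) := mul_nonneg hlam.le (by linarith)
    simp only [lintegral_const, measure_univ, mul_one] at h3
    rw [← ENNReal.ofReal_one, ← ENNReal.ofReal_add hle zero_le_one,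
      ← ENNReal.ofReal_add hX0 (by linarith)] at h3
    have h4 := ENNReal.toReal_mono ENNReal.ofReal_ne_top h3
    rw [ENNReal.toReal_mul, ENNReal.toReal_ofReal hκ0, ENNReal.toReal_ofReal (by linarith)] at h4
    linarith
  have hratio : ∀ᵐ ω ∂μ, X ω / (lam * t) ≤
      X ω / (X ω + (nEsc v ρ D (fun i => a i ω) (fun i => θ i ω) (p ω) t : ℝ)) +
        |1 - (firstAfter (marks a θ ω) (t - T) : ℝ) / (lam * t)| := by
    filter_upwards [h.ae_regular hlam, hXQ] with ω hω hle
    have h1 := nCapt_add_nEsc hv hD hω (p ω) t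
    have h2 := (abs_le.1 (abs_div_sub_div_le (x := lam * t) (Nat.cast_nonneg _) hle)).1
    rw [hX, ← Nat.cast_add, h1]
    linarith
  have hRint : Integrable (fun ω =>
      X ω / (X ω + (nEsc v ρ D (fun i => a i ω) (fun i => θ i ω) (p ω) t : ℝ))) μ := by
    refine Integrable.of_bound (C := 1) ?_ (ae_of_all _ fun ω => ?_)
    · refine AEStronglyMeasurable.congr (f := fun ω => X ω /
        (firstAfter (marks a θ ω) (t - T) : ℝ))
        (hXm.div hQint.1.aemeasurable).aestronglyMeasurable ?_
      filter_upwards [h.ae_regular hlam] with ω hω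
      have h1 := nCapt_add_nEsc hv hD hω (p ω) t
      rw [hX, ← Nat.cast_add, h1]
    · rw [Real.norm_of_nonneg (nCapt_div_nonneg _ _ _)]
      exact nCapt_div_le_one _ _ _
  have habs := integrable_abs_one_sub hlam (t - T) (lam * t)
  have hint := integral_mono_ae (hXint.div_const (lam * t))
    (hRint.add (h.integrable_comp habs)) hratio
  rw [integral_div] at hint
  simp only [Pi.add_apply] at hint
  rw [integral_add hRint (h.integrable_comp habs), h.integral_comp habs] at hint
  have h5 := div_le_div_of_nonneg_right hlower (by positivity : 0 ≤ lam * t)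
  rw [add_div] at h5
  linarith

/-- The Look-Ahead policy captures at least the stated fraction of what any motion along the
perimeter captures. -/
theorem mul_captureFraction_le (hv : 0 < v) (hρ : 0 < ρ) (hlam : 0 < lam)
    (hD : v * Real.pi * ρ ≤ D - ρ) (htargets : IsTargetProcess μ lam a θ) {φ₀ : Angle}
    {rule : LongestPathRule v ρ} {pLA p : Ω → ℝ → Angle}
    (hLA_meas : ∀ t, Measurable (fun ω => pLA ω t))
    (hLA : ∀ᵐ ω ∂μ, FollowsLA v ρ D rule φ₀ (fun i => a i ω) (fun i => θ i ω) (pLA ω))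
    (hp : ∀ᵐ ω ∂μ, IsPerimeterMotion ρ (p ω)) :
    (1 - v * Real.pi * ρ / (D - ρ)) * captureFraction μ v ρ D a θ p ≤
      captureFraction μ v ρ D a θ pLA := by
  have hT : ρ * Real.pi ≤ (D - ρ) / v := by
    rw [le_div_iff₀ hv]; linarith
  have hρπ : 0 < ρ * Real.pi := mul_pos hρ Real.pi_pos
  have hT0 : 0 < (D - ρ) / v := hρπ.trans_le hT
  have hDρ : 0 < D - ρ := (div_pos_iff_of_pos_right hv).1 hT0
  have hκ : 1 - v * Real.pi * ρ / (D - ρ) = 1 - ρ * Real.pi / ((D - ρ) / v) := by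
    field_simp
  have hκ0 : 0 ≤ 1 - ρ * Real.pi / ((D - ρ) / v) := sub_nonneg.2 ((div_le_one hT0).2 hT)
  have hκ1 : 1 - ρ * Real.pi / ((D - ρ) / v) ≤ 1 := by
    have : 0 ≤ ρ * Real.pi / ((D - ρ) / v) := by positivity
    linarith
  rw [hκ]
  have hδ := tendsto_integral_abs_one_sub hlam hT0.le
  -- Exchanging the denominator costs one mean deviation in the upper and one in the lower bound,
  -- hence the factor `2`.
  have hr : Tendsto (fun t : ℝ =>
      2 * ∫ ξ, |1 - (firstAfter ξ (t - (D - ρ) / v) : ℝ) / (lam * t)|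
        ∂seqLaw (markLaw lam) +
      (lam * (2 * ((D - ρ) / v)) + 1) / (lam * t)) atTop (nhds 0) := by
    have h1 := (hδ.const_mul 2).add (Tendsto.const_div_atTop
      (tendsto_id.const_mul_atTop hlam) (lam * (2 * ((D - ρ) / v)) + 1))
    simpa using h1
  refine mul_limsup_le_limsup hκ0
    (fun t => integral_nonneg fun ω => nCapt_div_nonneg _ _ _)
    (fun t => integral_nCapt_div_le_one _ _)
    (fun t => integral_nCapt_div_le_one _ _) hr ?_
  filter_upwards [eventually_ge_atTop ((D - ρ) / v)] with t ht
  have h1 := integral_nCapt_div_le htargets hlam hv hρ (by linarith)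
    hp (by linarith) ht
  have h2 := le_integral_nCapt_div htargets hlam hv hρ hT hLA_meas hLA ht
  have hδ0 : 0 ≤ ∫ ξ, |1 - (firstAfter ξ (t - (D - ρ) / v) : ℝ) / (lam * t)|
      ∂seqLaw (markLaw lam) := integral_nonneg fun ξ => abs_nonneg _
  have h3 := mul_le_mul_of_nonneg_left h1 hκ0
  have h4 := mul_le_of_le_one_left hδ0 hκ1
  rw [mul_add, ← mul_div_assoc] at h3
  linarith

end Comparison

end RIT

theorem mainTheorem3 {Ω : Type*} [MeasurableSpace Ω] (μ : MeasureTheory.Measure Ω)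
    [MeasureTheory.IsProbabilityMeasure μ]
    (v ρ D lam : ℝ) (hv : 0 < v) (hv1 : v < 1) (hρ : 0 < ρ) (hlam : 0 < lam)
    (hD : v * Real.pi * ρ ≤ D - ρ)
    (a : ℕ → Ω → ℝ) (θ : ℕ → Ω → RIT.Angle) (htargets : RIT.IsTargetProcess μ lam a θ)
    (φ₀ : RIT.Angle) (rule : RIT.LongestPathRule v ρ)
    (pLA pNCLA : Ω → ℝ → RIT.Angle)
    (hLA_meas : ∀ t, Measurable (fun ω => pLA ω t))
    (hNCLA_meas : ∀ t, Measurable (fun ω => pNCLA ω t))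
    (hLA : ∀ᵐ ω ∂μ, RIT.FollowsLA v ρ D rule φ₀ (fun i => a i ω) (fun i => θ i ω) (pLA ω))
    (hNCLA : ∀ᵐ ω ∂μ, RIT.FollowsNCLA v ρ D φ₀ (fun i => a i ω) (fun i => θ i ω) (pNCLA ω)) :
    (1 - v * Real.pi * ρ / (D - ρ)) * RIT.captureFraction μ v ρ D a θ pNCLA ≤
      RIT.captureFraction μ v ρ D a θ pLA := by
  have := RIT.isProbabilityMeasure_markLaw hlam
  exact RIT.mul_captureFraction_le hv hρ hlam hD htargets hLA_meas hLA
    (hNCLA.mono fun ω hω => hω.1)
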